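/- Let $d\ge 2$, $X\subseteq\mathbb R^d$ closed and convex, $\zeta$ a random element of a measurable space $\Xi$, and $f(x)=\mathbb E[F(x,\zeta)]$, where the expectation is finite for every $x\in\mathbb R^d$, $f$ and all $F(\cdot,\zeta)$ are differentiable on $\mathbb R^d$, and the gradient $\nabla F$ of $F$ in $x$ is measurable on $X\times\Xi$ with $\mathbb E[\nabla F(x,\zeta)]=\nabla f(x)$ for $x\in X$. Suppose that for some $\sigma_\infty$, some $L\ge 0$ and some $\underline f\in\mathbb R$, for all $x,y\in X$, $$\mathbb E\|\nabla F(x,\zeta)-\nabla f(x)\|_\infty^2\le\sigma_\infty^2,\qquad \mathbb E\|\nabla F(x,\zeta)-\nabla F(y,\zeta)\|_\infty^2\le L^2\|x-y\|_1^2,\qquad f(x)\ge\underline f .$$ Let $\eta,\hat\rho>0$ and let $K,q,m,m_1\ge 1$ be integers. Let $x^1$ be a random vector in $X$ with $f(x^1)$ integrable and, for $k=1,\dots,K$, let $$x^{k+1}=\operatorname*{arg\,min}_{x\in X}\Big\{\tfrac12\|x-(x^k-\eta G^k)\|_2^2+\tfrac{\hat\rho}{2}\|x-x^k\|_1^2\Big\},$$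 $$G^k=\frac1{m_1}\sum_{i=1}^{m_1}\nabla F(x^k,\zeta^k_i)\ \text{ if } k\equiv1 \ (\mathrm{mod}\ q),\qquad G^k=\frac1m\sum_{i=1}^{m}\big(\nabla F(x^k,\zeta^k_i)-\nabla F(x^{k-1},\zeta^k_i)\big)+G^{k-1}\ \text{ otherwise,}$$ where the $\zeta^k_i$ are i.i.d. copies of $\zeta$, independent of $x^1$. Let $Y$ be uniform on $\{1,\dots,K\}$ and independent of $x^1$ and all $\zeta^k_i$. Put $\Delta_f=\mathbb E[f(x^1)]-\underline f$, $\Omega=e^2\log d$, $c=e^2$ and $t=2\eta/\hat\rho$. If $\frac{\hat\rho}{4\eta}-\frac L2-\frac{2t\Omega^2L^2q}{m}>0$, then $$\mathbb E\big[\operatorname{dist}_{\|\cdot\|_\infty}(0,\partial(f+\delta_X)(x^{Y+1}))\big]\le\Big(L+\frac{\hat\rho+1}{\eta}+\sqrt{\frac{4\Omega^2L^2q}{m}}\Big)\sqrt{\frac{\frac{\Delta_f}{K}+\frac{t\,\Omega\, c(\log d)\,\sigma_\infty^2}{2m_1}}{\frac{\hat\rho}{4\eta}-\frac L2-\frac{2t\Omega^2L^2q}{m}}}+\sqrt{\frac{\Omega\,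 c(\log d)\,\sigma_\infty^2}{m_1}} .$$ Here $\delta_X$ is $0$ on $X$ and $+\infty$ elsewhere, $\partial$ is the (Fréchet) subdifferential, so that $\partial(f+\delta_X)(x)=\nabla f(x)+\mathcal N_X(x)$ for $x\in X$, with $\mathcal N_X(x)$ the normal cone, and $\operatorname{dist}_{\|\cdot\|_\infty}(0,S)=\inf_{v\in S}\|v\|_\infty$. -/

import Mathlib

open MeasureTheory ProbabilityTheory
open scoped ENNReal Topology

namespace Spider

/-- `ℝ^d`; the norm `‖·‖` is the Euclidean one. -/
abbrev Vec (d : ℕ) : Type := EuclideanSpace ℝ (Fin d)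

/-- The `ℓ₁` norm on `ℝ^d`. -/
def l1Norm {d : ℕ} (x : Vec d) : ℝ := ∑ i, |x i|

/-- The `ℓ_∞` norm on `ℝ^d` (Mathlib's norm on `Fin d → ℝ` is the sup norm). -/
noncomputable def linfNorm {d : ℕ} (x : Vec d) : ℝ := ‖(fun i => x i : Fin d → ℝ)‖

/-! ### The stationarity residual -/

/-- The indicator function `δ_X` of convex analysis: `0` on `X`, `+∞` outside `X`. -/
noncomputable def convexIndicator {d : ℕ} (X : Set (Vec d)) (x : Vec d) : EReal :=
  open Classical in if x ∈ X then 0 else ⊤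

/-- The (Fréchet, or regular) subdifferential of an extended-real-valued function `g` at `x`: the
vectors `v` with `g y ≥ g x + ⟨v, y - x⟩ - o(‖y - x‖)`; it is empty where `g` is not finite.
For convex `g` it is the subdifferential of convex analysis. For `g = f + δ_X` with `X` convex
closed, `f` differentiable and `∇f` continuous on `X` it is `∇f(x) + N_X(x)`, which is also the
limiting subdifferential. -/
def subdifferential {d : ℕ} (g : Vec d → EReal) (x : Vec d) : Set (Vec d) :=
  {v | g x ≠ ⊤ ∧ g x ≠ ⊥ ∧ ∀ ε : ℝ, 0 < ε → ∀ᶠ y in 𝓝 x,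
    g x + ((inner ℝ v (y - x) - ε * ‖y - x‖ : ℝ) : EReal) ≤ g y}

/-- `dist_{‖·‖_∞}(0, ∂(f + δ_X)(x)) = inf {‖v‖_∞ | v ∈ ∂(f + δ_X)(x)}`, which is `+∞` when the
subdifferential is empty. -/
noncomputable def residual {d : ℕ} (f : Vec d → ℝ) (X : Set (Vec d)) (x : Vec d) : ℝ≥0∞ :=
  ⨅ v ∈ subdifferential (fun y => (f y : EReal) + convexIndicator X y) x,
    ENNReal.ofReal (linfNorm v)

/-! ### The stochastic optimization problem -/

/-- The objective `f(x) = E[F(x, ζ)]`, where `ζ` has law `P`. -/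
noncomputable def objective {d : ℕ} {Ξ : Type*} [MeasurableSpace Ξ]
    (F : Vec d → Ξ → ℝ) (P : Measure Ξ) (x : Vec d) : ℝ := ∫ z, F x z ∂P

/-- The stochastic gradient `∇F(x, z)`, the gradient being with respect to `x`. -/
noncomputable def stochGrad {d : ℕ} {Ξ : Type*} (F : Vec d → Ξ → ℝ) (x : Vec d) (z : Ξ) : Vec d :=
  gradient (fun y => F y z) x

/-- The standing assumptions on the problem `min {f(x) = E[F(x, ζ)] | x ∈ X}`, the stochastic
gradient oracle being `∇F(x, ζ)`. -/
structure IsStochasticProgram {d : ℕ} {Ξ : Type*} [MeasurableSpace Ξ]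
    (X : Set (Vec d)) (F : Vec d → Ξ → ℝ) (P : Measure Ξ) : Prop where
  isClosed : IsClosed X
  convex : Convex ℝ X
  integrable : ∀ x, Integrable (F x) P
  differentiable : Differentiable ℝ (objective F P)
  sample_differentiable : ∀ z, Differentiable ℝ (fun x => F x z)
  measurable_grad : Measurable (fun p : X × Ξ => stochGrad F (p.1 : Vec d) p.2)
  integrable_grad : ∀ x ∈ X, Integrable (stochGrad F x) P
  unbiased : ∀ x ∈ X, ∫ z, stochGrad F x z ∂P = gradient (objective F P) x

/-- `E[‖∇F(x, ζ) - ∇f(x)‖_∞²] ≤ σ²` for all `x ∈ X`. -/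
def BoundedVariance {d : ℕ} {Ξ : Type*} [MeasurableSpace Ξ]
    (X : Set (Vec d)) (F : Vec d → Ξ → ℝ) (P : Measure Ξ) (σ : ℝ) : Prop :=
  ∀ x ∈ X,
    Integrable (fun z => linfNorm (stochGrad F x z - gradient (objective F P) x) ^ 2) P ∧
    ∫ z, linfNorm (stochGrad F x z - gradient (objective F P) x) ^ 2 ∂P ≤ σ ^ 2

/-- `E[‖∇F(x, ζ) - ∇F(y, ζ)‖_∞²] ≤ L² ‖x - y‖₁²` for all `x, y ∈ X`. -/
def MeanSquaredSmooth {d : ℕ} {Ξ : Type*} [MeasurableSpace Ξ]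
    (X : Set (Vec d)) (F : Vec d → Ξ → ℝ) (P : Measure Ξ) (L : ℝ) : Prop :=
  ∀ x ∈ X, ∀ y ∈ X,
    Integrable (fun z => linfNorm (stochGrad F x z - stochGrad F y z) ^ 2) P ∧
    ∫ z, linfNorm (stochGrad F x z - stochGrad F y z) ^ 2 ∂P ≤ L ^ 2 * l1Norm (x - y) ^ 2

/-! ### The algorithm -/

/-- `φ(z) = (ρ/2) ‖z‖₁²`. -/
noncomputable def proxTerm {d : ℕ} (ρ : ℝ) (z : Vec d) : ℝ := ρ / 2 * l1Norm z ^ 2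

/-- `x'` is a point of `argmin {½ ‖y - v‖² + φ(y - x) | y ∈ X}`. -/
def IsProxPoint {d : ℕ} (X : Set (Vec d)) (φ : Vec d → ℝ) (x v x' : Vec d) : Prop :=
  x' ∈ X ∧ IsMinOn (fun y => 1 / 2 * ‖y - v‖ ^ 2 + φ (y - x)) X x'

/-- The batch size `m_k`: `m₁` when an epoch of length `q` starts at iteration `k`, i.e. when
`k ≡ 1` modulo `q`, and `m` otherwise. -/
def batchSize (q m m₁ k : ℕ) : ℕ := if k ≡ 1 [MOD q] then m₁ else m

/-- The variance-reduced estimate at iteration `k`, with epoch length `q` and batch size `mk`, from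
the points `x = x^k`, `x' = x^{k-1}`, the estimate `g' = G^{k-1}` and the samples
`z 0, …, z (mk - 1)` of iteration `k`. -/
noncomputable def spiderEstimate {d : ℕ} {Ξ : Type*} (F : Vec d → Ξ → ℝ) (q k mk : ℕ)
    (x x' g' : Vec d) (z : ℕ → Ξ) : Vec d :=
  if k ≡ 1 [MOD q] then
    (1 / (mk : ℝ)) • ∑ i ∈ Finset.range mk, stochGrad F x (z i)
  else
    (1 / (mk : ℝ)) • (∑ i ∈ Finset.range mk, stochGrad F x (z i)
      - ∑ i ∈ Finset.range mk, stochGrad F x' (z i)) + g'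

/-- A run of `K` iterations of the proximal stochastic first-order method with step size `η`,
proximal term `φ` and variance-reduced gradient estimates. On the probability space `(Ω, μ)`,
`ζ k i` are the samples of iteration `k`, `x k` the iterates (from `x 1` on), `G k` the gradient
estimates, and `Y` the random index of the output `x (Y + 1)`. -/
structure IsRun {d : ℕ} {Ξ : Type*} [MeasurableSpace Ξ] {Ω : Type*} [MeasurableSpace Ω]
    (X : Set (Vec d)) (F : Vec d → Ξ → ℝ) (P : Measure Ξ) (φ : Vec d → ℝ) (η : ℝ)
    (K q m m₁ : ℕ) (μ : Measure Ω) (ζ : ℕ → ℕ → Ω → Ξ) (x G : ℕ → Ω → Vec d) (Y : Ω → ℕ) :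
    Prop where
  /-- The samples are i.i.d. with law `P`. -/
  sample_measurable : ∀ k i, Measurable (ζ k i)
  sample_law : ∀ k i, μ.map (ζ k i) = P
  sample_indep : iIndepFun (fun p : ℕ × ℕ => ζ p.1 p.2) μ
  /-- The (possibly random) initial point lies in `X` and is independent of the samples. -/
  init_measurable : Measurable (x 1)
  init_mem : ∀ ω, x 1 ω ∈ X
  init_indep : IndepFun (x 1) (fun ω => fun p : ℕ × ℕ => ζ p.1 p.2 ω) μ
  /-- The gradient estimate and the proximal step of iteration `k`. -/
  estimate : ∀ k ∈ Finset.Icc 1 K, ∀ ω,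
    G k ω = spiderEstimate F q k (batchSize q m m₁ k) (x k ω) (x (k - 1) ω) (G (k - 1) ω)
      (fun i => ζ k i ω)
  step : ∀ k ∈ Finset.Icc 1 K, ∀ ω,
    IsProxPoint X φ (x k ω) (x k ω - η • G k ω) (x (k + 1) ω)
  /-- `Y` is uniform on `{1, …, K}` and independent of everything else. -/
  index_measurable : Measurable Y
  index_law : ∀ k ∈ Finset.Icc 1 K, μ {ω | Y ω = k} = (K : ℝ≥0∞)⁻¹
  index_indep : IndepFun Y (fun ω => (x 1 ω, fun p : ℕ × ℕ => ζ p.1 p.2 ω)) μ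

/-- `Ω = e² log d`. -/
noncomputable def dimFactor (d : ℕ) : ℝ := Real.exp 2 * Real.log d

end Spider

namespace Spider

variable {d : ℕ}


/-! ### The `ℓ₁` and `ℓ_∞` norms -/

/-! The difficulty is that `‖·‖_∞²` is not smooth, so variances of sums do not simply add. It is
replaced by the potential `V = ‖·‖_{2r}²` with `r = ⌈log d⌉`, which lies between `‖·‖_∞²` and `e
‖·‖_∞²` and satisfies `V(x+y) + V(x-y) ≤ 2V(x) + 2(4r-3)V(y)` (`lpSq_add_add_lpSq_sub_le`).
Integrating this against a centred `y` and applying Jensen to the reflected term gives `E V(x+y) ≤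
V(x) + 2(4r-3) E V(y)`. Hence averaging `n` fresh centred samples adds at most `Ω²/n` times their
second moment in `ℓ_∞`, because `2(4r-3)e ≤ Ω²`.

Write `E_k` for the mean potential of the gradient error and `D_k = E‖x^{k+1} - x^k‖₁²`. A restart
gives `E_k ≤ A = Ω²σ²/m₁`. An update gives `E_{k+1} ≤ E_k + B D_k` with `B = 4Ω²L²/m`, with
coefficient one on `E_k` since the old error is known before the new samples are drawn. Unrolling
within epochs, where each `D_j` is used at most `q` times, yields `∑E ≤ KA + qB ∑D`. The proximal
step decreases the objective: `(ρ/(4η) - L/2) D_k + Φ_{k+1} ≤ Φ_k + (η/ρ) E_k`, where `Φ_k` is the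
mean of `f(x^k)` minus its lower bound. The two sums therefore bound each other, and the positive
gap in the hypothesis closes the loop (`recursion_bound`).

Optimality of the proximal step gives a subgradient at `x^{k+1}` of size at most `(L +
(ρ+1)/η)‖x^{k+1} - x^k‖₁` plus the gradient error (`residual_le_of_isProxPoint`). Cauchy–Schwarz
over the sample space and the uniform index turns the bounds on `∑D` and `∑E` into the claim.

All moments are lower integrals in `ℝ≥0∞`, so integrability along the run need not be assumed:
finiteness comes out of the recursion. Measurability of the iterates comes from continuity of the
proximal map, and that of the residual from a projection of closed sets along a compact ball. -/

lemma linfNorm_nonneg (x : Vec d) : 0 ≤ linfNorm x := norm_nonneg _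

lemma abs_le_linfNorm (x : Vec d) (i : Fin d) : |x i| ≤ linfNorm x :=
  norm_le_pi_norm (fun i => x i : Fin d → ℝ) i

lemma linfNorm_le {x : Vec d} {r : ℝ} (hr : 0 ≤ r) (h : ∀ i, |x i| ≤ r) : linfNorm x ≤ r :=
  (pi_norm_le_iff_of_nonneg hr).2 h

lemma linfNorm_add_le (x y : Vec d) : linfNorm (x + y) ≤ linfNorm x + linfNorm y :=
  norm_add_le (fun i => x i : Fin d → ℝ) (fun i => y i)

lemma linfNorm_sub_le (x y : Vec d) : linfNorm (x - y) ≤ linfNorm x + linfNorm y :=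
  norm_sub_le (fun i => x i : Fin d → ℝ) (fun i => y i)

lemma linfNorm_smul (a : ℝ) (x : Vec d) : linfNorm (a • x) = |a| * linfNorm x :=
  norm_smul a (fun i => x i : Fin d → ℝ)

lemma continuous_linfNorm : Continuous (linfNorm : Vec d → ℝ) := by
  unfold linfNorm; fun_prop

lemma l1Norm_nonneg (x : Vec d) : 0 ≤ l1Norm x := Finset.sum_nonneg fun _ _ => abs_nonneg _

lemma l1Norm_zero : l1Norm (0 : Vec d) = 0 := by simp [l1Norm]

lemma l1Norm_add_le (x y : Vec d) : l1Norm (x + y) ≤ l1Norm x + l1Norm y := by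
  unfold l1Norm
  rw [← Finset.sum_add_distrib]
  exact Finset.sum_le_sum fun i _ => abs_add_le _ _

lemma l1Norm_smul (a : ℝ) (x : Vec d) : l1Norm (a • x) = |a| * l1Norm x := by
  simp [l1Norm, abs_mul, Finset.mul_sum]

lemma l1Norm_neg (x : Vec d) : l1Norm (-x) = l1Norm x := by simp [l1Norm]

lemma l1Norm_sub_comm (x y : Vec d) : l1Norm (x - y) = l1Norm (y - x) := by
  rw [← neg_sub, l1Norm_neg]

lemma continuous_l1Norm : Continuous (l1Norm : Vec d → ℝ) := by
  unfold l1Norm; fun_prop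

lemma linfNorm_le_l1Norm (x : Vec d) : linfNorm x ≤ l1Norm x :=
  linfNorm_le (l1Norm_nonneg x) fun i =>
    Finset.single_le_sum (f := fun i => |x i|) (fun _ _ => abs_nonneg _) (Finset.mem_univ i)

lemma abs_inner_le (x y : Vec d) : |inner ℝ x y| ≤ linfNorm x * l1Norm y := by
  rw [PiLp.inner_apply, l1Norm, Finset.mul_sum]
  refine (Finset.abs_sum_le_sum_abs _ _).trans (Finset.sum_le_sum fun i _ => ?_)
  rw [real_inner_eq_re_inner, RCLike.inner_apply]
  simp only [conj_trivial, RCLike.re_to_real, abs_mul]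
  rw [mul_comm]
  exact mul_le_mul_of_nonneg_right (abs_le_linfNorm x i) (abs_nonneg _)

lemma l1Norm_le_mul_norm (x : Vec d) : l1Norm x ≤ d * ‖x‖ := by
  have : ∀ i ∈ (Finset.univ : Finset (Fin d)), |x i| ≤ ‖x‖ := fun i _ => PiLp.norm_apply_le x i
  simpa [l1Norm] using Finset.sum_le_sum this

lemma norm_le_l1Norm (x : Vec d) : ‖x‖ ≤ l1Norm x := by
  have h := abs_inner_le x x
  rw [real_inner_self_eq_norm_sq, abs_of_nonneg (sq_nonneg _)] at h
  have h2 : ‖x‖ ^ 2 ≤ l1Norm x ^ 2 :=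
    h.trans (by nlinarith [linfNorm_le_l1Norm x, l1Norm_nonneg x])
  exact le_of_sq_le_sq h2 (l1Norm_nonneg x)

/-! ### The power-mean potential -/

/-- The quotient of `u^(n+1) - v^(n+1)` by `u - v` is a sum of `n+1` monomials `u^i v^(n-i)`, whose
average is at most `(u^n + v^n)/2`. The induction obtains this from Chebyshev's inequality
(`hcheb`). -/
lemma pow_sub_pow_mul_sub_le {u v : ℝ} (hu : 0 ≤ u) (hv : 0 ≤ v) (n : ℕ) :
    (u ^ (n + 1) - v ^ (n + 1)) * (u - v)
      ≤ (n + 1) / 2 * (u - v) ^ 2 * (u ^ n + v ^ n) := by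
  induction n with
  | zero => apply le_of_eq; simp; ring
  | succ n ih =>
    have hmono : 0 ≤ (u - v) * (u ^ (n + 1) - v ^ (n + 1)) := by
      rcases le_total u v with h | h
      · exact mul_nonneg_of_nonpos_of_nonpos (by linarith)
          (by have := pow_le_pow_left₀ hu h (n + 1); linarith)
      · exact mul_nonneg (by linarith) (by have := pow_le_pow_left₀ hv h (n + 1); linarith)
    have hcheb : (u + v) * (u ^ n + v ^ n) ≤ 2 * (u ^ (n + 1) + v ^ (n + 1)) := by
      have : 0 ≤ (u - v) * (u ^ n - v ^ n) := by
        rcases le_total u v with h | h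
        · exact mul_nonneg_of_nonpos_of_nonpos (by linarith)
            (by have := pow_le_pow_left₀ hu h n; linarith)
        · exact mul_nonneg (by linarith) (by have := pow_le_pow_left₀ hv h n; linarith)
      calc _ ≤ (u + v) * (u ^ n + v ^ n) + (u - v) * (u ^ n - v ^ n) := by linarith
        _ = _ := by ring
    have e : (u ^ (n + 1 + 1) - v ^ (n + 1 + 1)) * (u - v)
        = (u + v) / 2 * ((u ^ (n + 1) - v ^ (n + 1)) * (u - v))
          + (u - v) ^ 2 / 2 * (u ^ (n + 1) + v ^ (n + 1)) := by ring
    rw [e]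
    calc _ ≤ (u + v) / 2 * ((n + 1) / 2 * (u - v) ^ 2 * (u ^ n + v ^ n))
          + (u - v) ^ 2 / 2 * (u ^ (n + 1) + v ^ (n + 1)) := by gcongr
      _ = (n + 1) / 4 * (u - v) ^ 2 * ((u + v) * (u ^ n + v ^ n))
          + (u - v) ^ 2 / 2 * (u ^ (n + 1) + v ^ (n + 1)) := by ring
      _ ≤ (n + 1) / 4 * (u - v) ^ 2 * (2 * (u ^ (n + 1) + v ^ (n + 1)))
          + (u - v) ^ 2 / 2 * (u ^ (n + 1) + v ^ (n + 1)) := by gcongr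
      _ = _ := by push_cast; ring

/-- The scalar two-point inequality behind smoothness of the potential. Two consecutive exponents
are carried because the recursion `e` for exponent `n+2` involves the sum at `n+1` and, through the
difference bound, the sum at `n`. -/
lemma pow_add_pow_le (a b c : ℝ) (r : ℕ) (hc : (4 * r + 1 : ℝ) ≤ c) :
    ((a + b) ^ 2) ^ r + ((a - b) ^ 2) ^ r ≤ 2 * (a ^ 2 + c * b ^ 2) ^ r ∧
    ((a + b) ^ 2) ^ (r + 1) + ((a - b) ^ 2) ^ (r + 1) ≤ 2 * (a ^ 2 + c * b ^ 2) ^ (r + 1) := by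
  have hc1 : 1 ≤ c := by have : (0 : ℝ) ≤ r := r.cast_nonneg; linarith
  induction r with
  | zero =>
    refine ⟨by norm_num, ?_⟩
    simp only [zero_add, pow_one]
    nlinarith [mul_nonneg (sub_nonneg.2 hc1) (sq_nonneg b)]
  | succ n ih =>
    push_cast at hc
    obtain ⟨h0, h1⟩ := ih (by linarith)
    refine ⟨h1, ?_⟩
    set u := (a + b) ^ 2
    set v := (a - b) ^ 2
    have hu : 0 ≤ u := sq_nonneg _
    have hv : 0 ≤ v := sq_nonneg _
    set M := a ^ 2 + c * b ^ 2
    have hM : 0 ≤ M := by positivity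
    have e : u ^ (n + 1 + 1) + v ^ (n + 1 + 1)
        = (a ^ 2 + b ^ 2) * (u ^ (n + 1) + v ^ (n + 1))
          + 1 / 2 * ((u ^ (n + 1) - v ^ (n + 1)) * (u - v)) := by
      have : a ^ 2 + b ^ 2 = (u + v) / 2 := by simp only [u, v]; ring
      rw [this]; ring
    have e2 : (u - v) ^ 2 = 16 * a ^ 2 * b ^ 2 := by simp only [u, v]; ring
    have h3 := pow_sub_pow_mul_sub_le hu hv n
    rw [e2] at h3
    have h4 : (n + 1 : ℝ) / 2 * (16 * a ^ 2 * b ^ 2) * (u ^ n + v ^ n)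
        ≤ (n + 1 : ℝ) / 2 * (16 * a ^ 2 * b ^ 2) * (2 * M ^ n) := by gcongr
    have h5 : (a ^ 2 + b ^ 2) * (u ^ (n + 1) + v ^ (n + 1))
        ≤ (a ^ 2 + b ^ 2) * (2 * M ^ (n + 1)) := by gcongr
    -- The only use of the size of `c`: `M² - (a²+b²)M = (c-1)b²M ≥ (c-1)a²b²`, so `c - 1 ≥ 4(n+1)`
    -- suffices.
    have h6 : (a ^ 2 + b ^ 2) * M + 4 * (n + 1) * (a ^ 2 * b ^ 2) ≤ M * M := by
      have h7 : a ^ 2 ≤ M := by simp only [M]; nlinarith [sq_nonneg b]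
      have h8 : 4 * ((n : ℝ) + 1) * (a ^ 2 * b ^ 2) ≤ (c - 1) * b ^ 2 * M := by
        calc 4 * ((n : ℝ) + 1) * (a ^ 2 * b ^ 2) ≤ (c - 1) * (a ^ 2 * b ^ 2) := by
              gcongr; linarith
          _ = (c - 1) * b ^ 2 * a ^ 2 := by ring
          _ ≤ _ := by
              have : 0 ≤ (c - 1) * b ^ 2 := mul_nonneg (by linarith) (sq_nonneg b)
              gcongr
      have : M * M = (a ^ 2 + b ^ 2) * M + (c - 1) * b ^ 2 * M := by simp only [M]; ring
      linarith
    have h9 := mul_le_mul_of_nonneg_left h6 (pow_nonneg hM n)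
    rw [e]
    calc _ ≤ (a ^ 2 + b ^ 2) * (2 * M ^ (n + 1))
          + 1 / 2 * ((n + 1 : ℝ) / 2 * (16 * a ^ 2 * b ^ 2) * (2 * M ^ n)) := by linarith
      _ = 2 * (M ^ n * ((a ^ 2 + b ^ 2) * M + 4 * (n + 1) * (a ^ 2 * b ^ 2))) := by ring
      _ ≤ 2 * (M ^ n * (M * M)) := by linarith
      _ = _ := by ring

/-- The square of the `ℓ_{2p}` norm. -/
noncomputable def lpSq (p : ℝ) (x : Vec d) : ℝ := (∑ i, (x i ^ 2) ^ p) ^ (1 / p)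

variable {p : ℝ}

lemma lpSq_nonneg (x : Vec d) : 0 ≤ lpSq p x := by unfold lpSq; positivity

lemma continuous_lpSq (hp : 1 ≤ p) : Continuous (lpSq p : Vec d → ℝ) := by
  unfold lpSq
  refine Continuous.rpow_const (continuous_finsetSum _ fun i _ => ?_) fun _ => Or.inr (by positivity)
  exact Continuous.rpow_const (by fun_prop) fun _ => Or.inr (by positivity)

lemma rpow_sum_mul {ι : Type*} (s : Finset ι) (f : ι → ℝ) (hf : ∀ i, 0 ≤ f i) {a : ℝ} (ha : 0 ≤ a)
    (hp : 1 ≤ p) :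
    (∑ i ∈ s, (a * f i) ^ p) ^ (1 / p) = a * (∑ i ∈ s, f i ^ p) ^ (1 / p) := by
  have hp0 : p ≠ 0 := by positivity
  simp_rw [Real.mul_rpow ha (hf _)]
  rw [← Finset.mul_sum, Real.mul_rpow (by positivity)
    (Finset.sum_nonneg fun i _ => Real.rpow_nonneg (hf i) _), ← Real.rpow_mul ha,
    mul_one_div_cancel hp0, Real.rpow_one]

lemma rpow_sum_combination_le (x y : Vec d) {a b : ℝ} (ha : 0 ≤ a) (hb : 0 ≤ b) (hp : 1 ≤ p) :
    (∑ i, (a * x i ^ 2 + b * y i ^ 2) ^ p) ^ (1 / p) ≤ a * lpSq p x + b * lpSq p y := by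
  have := Real.Lp_add_le_of_nonneg (Finset.univ) (f := fun i => a * x i ^ 2)
    (g := fun i => b * y i ^ 2) hp (fun i _ => by positivity) (fun i _ => by positivity)
  rwa [rpow_sum_mul _ (fun i => x i ^ 2) (fun i => sq_nonneg _) ha hp,
    rpow_sum_mul _ (fun i => y i ^ 2) (fun i => sq_nonneg _) hb hp] at this

/-- Squaring is convex in each coordinate, and the `ℓ_p` norm is monotone and subadditive on
nonnegative vectors. -/
lemma convexOn_lpSq (hp : 1 ≤ p) : ConvexOn ℝ Set.univ (lpSq p : Vec d → ℝ) := by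
  refine ⟨convex_univ, fun x _ y _ a b ha hb hab => ?_⟩
  refine le_trans ?_ (rpow_sum_combination_le x y ha hb hp)
  unfold lpSq
  gcongr with i
  simp only [PiLp.add_apply, PiLp.smul_apply, smul_eq_mul]
  have hb' : b = 1 - a := by linarith
  have : a * x i ^ 2 + b * y i ^ 2 - (a * x i + b * y i) ^ 2 = a * b * (x i - y i) ^ 2 := by
    rw [hb']; ring
  nlinarith [mul_nonneg (mul_nonneg ha hb) (sq_nonneg (x i - y i))]

lemma lpSq_smul (hp : 1 ≤ p) (a : ℝ) (x : Vec d) : lpSq p (a • x) = a ^ 2 * lpSq p x := by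
  have := rpow_sum_mul Finset.univ (fun i => x i ^ 2) (fun i => sq_nonneg _) (sq_nonneg a) hp
  simpa [lpSq, mul_pow] using this

lemma lpSq_zero (hp : 1 ≤ p) : lpSq p (0 : Vec d) = 0 := by
  simpa using lpSq_smul hp 0 (0 : Vec d)

lemma lpSq_neg (x : Vec d) : lpSq p (-x) = lpSq p x := by simp [lpSq]

/-- The `ℓ_{2r}` norm is `2`-uniformly smooth with a constant of order `r`. -/
lemma lpSq_add_add_lpSq_sub_le {r : ℕ} (hr : 1 ≤ r) (x y : Vec d) :
    lpSq r (x + y) + lpSq r (x - y) ≤ 2 * lpSq r x + 2 * (4 * r - 3) * lpSq r y := by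
  have hr' : (1 : ℝ) ≤ r := by exact_mod_cast hr
  -- Concavity of the `r`-th root bounds the average of the two potentials by the root of the
  -- averaged power sums, where the two-point inequality applies coordinatewise; Minkowski (`hle`)
  -- then separates `x` from `y`.
  have hconc := (Real.concaveOn_rpow (p := 1 / (r : ℝ)) (by positivity)
    (by rw [div_le_one (by positivity)]; exact hr')).2
    (Set.mem_Ici.2 (show 0 ≤ ∑ i, ((x + y) i ^ 2) ^ (r : ℝ) by positivity))
    (Set.mem_Ici.2 (show 0 ≤ ∑ i, ((x - y) i ^ 2) ^ (r : ℝ) by positivity))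
    (show (0 : ℝ) ≤ 1 / 2 by norm_num) (show (0 : ℝ) ≤ 1 / 2 by norm_num) (by norm_num)
  simp only [smul_eq_mul] at hconc
  have hle := rpow_sum_combination_le x y (a := 1) (b := 4 * r - 3) zero_le_one (by linarith) hr'
  have hmid : (1 / 2 * ∑ i, ((x + y) i ^ 2) ^ (r : ℝ) + 1 / 2 * ∑ i, ((x - y) i ^ 2) ^ (r : ℝ))
      ≤ ∑ i, (1 * x i ^ 2 + (4 * r - 3) * y i ^ 2) ^ (r : ℝ) := by
    rw [← mul_add, ← Finset.sum_add_distrib, Finset.mul_sum]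
    refine Finset.sum_le_sum fun i _ => ?_
    obtain ⟨n, rfl⟩ := Nat.exists_eq_add_of_le' hr
    -- With `r = n + 1`, the least admissible constant `4n + 1` is `4r - 3`.
    have := (pow_add_pow_le (x i) (y i) (4 * ((n + 1 : ℕ) : ℝ) - 3) n
      (by push_cast; linarith)).2
    simp only [Real.rpow_natCast, PiLp.add_apply, PiLp.sub_apply, one_mul]
    linarith
  have hmid' := Real.rpow_le_rpow (by positivity) hmid (z := 1 / (r : ℝ)) (by positivity)
  have e1 : lpSq r (x + y) = (∑ i, ((x + y) i ^ 2) ^ (r : ℝ)) ^ (1 / (r : ℝ)) := rfl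
  have e2 : lpSq r (x - y) = (∑ i, ((x - y) i ^ 2) ^ (r : ℝ)) ^ (1 / (r : ℝ)) := rfl
  rw [← e1, ← e2] at hconc
  linarith

lemma sq_linfNorm_le_lpSq (hp : 1 ≤ p) (x : Vec d) : linfNorm x ^ 2 ≤ lpSq p x := by
  have key : ∀ i, x i ^ 2 ≤ lpSq p x := fun i => by
    have h1 : (x i ^ 2) ^ p ≤ ∑ i, (x i ^ 2) ^ p :=
      Finset.single_le_sum (f := fun i => (x i ^ 2) ^ p) (fun _ _ => by positivity)
        (Finset.mem_univ i)
    have h2 := Real.rpow_le_rpow (by positivity) h1 (z := 1 / p) (by positivity)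
    rwa [← Real.rpow_mul (sq_nonneg _), mul_one_div_cancel (by positivity), Real.rpow_one] at h2
  have : linfNorm x ≤ √(lpSq p x) :=
    linfNorm_le (Real.sqrt_nonneg _) fun i => Real.abs_le_sqrt (key i)
  calc _ ≤ √(lpSq p x) ^ 2 := by gcongr; exact linfNorm_nonneg x
    _ = _ := Real.sq_sqrt (lpSq_nonneg x)

lemma lpSq_le_mul_sq_linfNorm (hp : 1 ≤ p) (x : Vec d) :
    lpSq p x ≤ (d : ℝ) ^ (1 / p) * linfNorm x ^ 2 := by
  have h : ∑ i, (x i ^ 2) ^ p ≤ ∑ _i : Fin d, (linfNorm x ^ 2) ^ p := by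
    refine Finset.sum_le_sum fun i _ => Real.rpow_le_rpow (sq_nonneg _) ?_ (by positivity)
    rw [← sq_abs]
    gcongr
    exact abs_le_linfNorm x i
  have h2 := Real.rpow_le_rpow (by positivity) h (z := 1 / p) (by positivity)
  rw [Finset.sum_const, Finset.card_univ, Fintype.card_fin, nsmul_eq_mul,
    Real.mul_rpow (by positivity) (by positivity), ← Real.rpow_mul (sq_nonneg _),
    mul_one_div_cancel (by positivity), Real.rpow_one] at h2
  exact h2

lemma lpSq_add_le (hp : 1 ≤ p) (x y : Vec d) : lpSq p (x + y) ≤ 2 * lpSq p x + 2 * lpSq p y := by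
  have h := (convexOn_lpSq (d := d) hp).2 (Set.mem_univ ((2 : ℝ) • x)) (Set.mem_univ ((2 : ℝ) • y))
    (show (0 : ℝ) ≤ 1 / 2 by norm_num) (show (0 : ℝ) ≤ 1 / 2 by norm_num) (by norm_num)
  rw [lpSq_smul hp, lpSq_smul hp, smul_smul, smul_smul] at h
  norm_num at h
  linarith

/-- The exponent `⌈log d⌉` of the potential. -/
noncomputable def logExponent (d : ℕ) : ℕ := ⌈Real.log d⌉₊

lemma log_two_le_log (hd : 2 ≤ d) : Real.log 2 ≤ Real.log d :=
  Real.log_le_log (by norm_num) (by exact_mod_cast hd)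

lemma one_le_logExponent (hd : 2 ≤ d) : 1 ≤ logExponent d :=
  Nat.one_le_ceil_iff.2 (lt_of_lt_of_le (Real.log_pos (by norm_num)) (log_two_le_log hd))

/-- Here `d^(1/r) = exp(log d / r)` with `r ≥ log d`: this choice of `r` keeps the distortion
between the potential and `ℓ_∞` bounded independently of `d`. -/
lemma rpow_inv_logExponent_le (hd : 2 ≤ d) :
    (d : ℝ) ^ (1 / (logExponent d : ℝ)) ≤ Real.exp 1 := by
  have h1 : (1 : ℝ) ≤ logExponent d := by exact_mod_cast one_le_logExponent hd
  rw [Real.rpow_def_of_pos (by positivity)]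
  apply Real.exp_le_exp.2
  rw [mul_one_div, div_le_one (by positivity)]
  exact Nat.le_ceil _

/-- Absorbs smoothness constant times distortion into `Ω² = e⁴ (log d)²`. After `r < log d + 1` and
cancelling a factor `e`, what remains is `2(4l+1) ≤ e³ l²`, true for `l ≥ log 2`. -/
lemma smoothness_constant_le (hd : 2 ≤ d) :
    2 * (4 * (logExponent d : ℝ) - 3) * Real.exp 1 ≤ dimFactor d ^ 2 := by
  have hl := log_two_le_log hd
  have h2 := Real.log_two_gt_d9
  have hr : (logExponent d : ℝ) < Real.log d + 1 := Nat.ceil_lt_add_one (by linarith)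
  have he := Real.exp_one_gt_d9
  have e2 : Real.exp 2 = Real.exp 1 ^ 2 := by rw [← Real.exp_nat_mul]; norm_num
  have e3 : (2.7 : ℝ) ^ 3 ≤ Real.exp 1 ^ 3 := by gcongr; linarith
  set l := Real.log d
  have h3 : 2 * (4 * l + 1) ≤ 2.7 ^ 3 * l ^ 2 := by nlinarith
  calc 2 * (4 * (logExponent d : ℝ) - 3) * Real.exp 1 ≤ 2 * (4 * l + 1) * Real.exp 1 := by
        gcongr; linarith
    _ ≤ (Real.exp 1 ^ 3 * l ^ 2) * Real.exp 1 := by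
        refine mul_le_mul_of_nonneg_right (h3.trans ?_) (Real.exp_pos 1).le
        exact mul_le_mul_of_nonneg_right e3 (sq_nonneg l)
    _ = _ := by unfold dimFactor; rw [e2]; ring


/-! ### Martingale moment bounds -/

section Martingale

variable {Ω Ξ β : Type*} [mΩ : MeasurableSpace Ω] [mΞ : MeasurableSpace Ξ] [mβ : MeasurableSpace β]
  {μ : Measure Ω} {P : Measure Ξ}

/-- Tonelli for the product law. It plays the part of conditioning on `U`. -/
lemma lintegral_comp_of_indepFun [IsProbabilityMeasure μ] {U : Ω → β} {ξ : Ω → Ξ}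
    (hU : Measurable U) (hξ : Measurable ξ) (hind : IndepFun U ξ μ) (hlaw : μ.map ξ = P)
    {φ : β × Ξ → ℝ≥0∞} (hφ : Measurable φ) :
    ∫⁻ ω, φ (U ω, ξ ω) ∂μ = ∫⁻ ω, ∫⁻ z, φ (U ω, z) ∂P ∂μ := by
  have : IsProbabilityMeasure P := hlaw ▸ Measure.isProbabilityMeasure_map hξ.aemeasurable
  have h := (indepFun_iff_map_prod_eq_prod_map_map hU.aemeasurable hξ.aemeasurable).1 hind
  rw [hlaw] at h
  rw [← lintegral_map (f := φ) (g := fun ω => (U ω, ξ ω)) hφ (hU.prodMk hξ), h,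
    lintegral_prod _ hφ.aemeasurable, lintegral_map hφ.lintegral_prod_right' hU]

lemma integrable_lpSq_const_add [IsProbabilityMeasure P] {p : ℝ} (hp : 1 ≤ p) (a : Vec d)
    {h : Ξ → Vec d} (hm : AEStronglyMeasurable h P) (hV : Integrable (fun z => lpSq p (h z)) P) :
    Integrable (fun z => lpSq p (a + h z)) P := by
  refine Integrable.mono' (((integrable_const (lpSq p a)).const_mul 2).add (hV.const_mul 2))
    ((continuous_lpSq hp).comp_aestronglyMeasurable (aestronglyMeasurable_const.add hm))
    (Filter.Eventually.of_forall fun z => ?_)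
  rw [Real.norm_of_nonneg (lpSq_nonneg _)]
  exact lpSq_add_le hp a (h z)

/-- Integrate the smoothness inequality. The reflected term satisfies `E V(a - h) ≥ V(a)` by Jensen,
since `h` is centred, and cancels one of the two copies of `V(a)`; no symmetry of `h` is needed. -/
lemma lintegral_lpSq_const_add_le [IsProbabilityMeasure P] {r : ℕ} (hr : 1 ≤ r) (a : Vec d)
    {h : Ξ → Vec d} (hint : Integrable h P) (hV : Integrable (fun z => lpSq r (h z)) P)
    (h0 : ∫ z, h z ∂P = 0) :
    ∫⁻ z, ENNReal.ofReal (lpSq r (a + h z)) ∂P ≤ ENNReal.ofReal (lpSq r a) +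
      ENNReal.ofReal (2 * (4 * r - 3)) * ∫⁻ z, ENNReal.ofReal (lpSq r (h z)) ∂P := by
  have hr' : (1 : ℝ) ≤ r := by exact_mod_cast hr
  have hc : (0 : ℝ) ≤ 2 * (4 * r - 3) := by linarith
  have hplus := integrable_lpSq_const_add hr' a hint.1 hV
  have hminus : Integrable (fun z => lpSq r (a - h z)) P := by
    have := integrable_lpSq_const_add hr' a hint.neg.1 (by simpa [lpSq_neg] using hV)
    simpa [sub_eq_add_neg] using this
  have hjensen : lpSq r a ≤ ∫ z, lpSq r (a - h z) ∂P := by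
    have := (convexOn_lpSq (d := d) hr').map_integral_le (μ := P) (f := fun z => a - h z)
      (continuous_lpSq hr').continuousOn isClosed_univ (Filter.Eventually.of_forall fun _ => trivial)
      ((integrable_const a).sub hint) hminus
    rwa [integral_sub (integrable_const a) hint, h0, integral_const, probReal_univ, one_smul,
      sub_zero] at this
  have hmain : ∫ z, lpSq r (a + h z) ∂P ≤ lpSq r a + 2 * (4 * r - 3) * ∫ z, lpSq r (h z) ∂P := by
    have h1 : ∫ z, (lpSq r (a + h z) + lpSq r (a - h z)) ∂P
        ≤ ∫ z, (2 * lpSq r a + 2 * (4 * r - 3) * lpSq r (h z)) ∂P :=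
      integral_mono (hplus.add hminus) ((integrable_const _).add (hV.const_mul _))
        fun z => lpSq_add_add_lpSq_sub_le hr a (h z)
    rw [integral_add hplus hminus, integral_add (integrable_const _) (hV.const_mul _),
      integral_const, probReal_univ, one_smul, integral_const_mul] at h1
    linarith
  rw [← ofReal_integral_eq_lintegral_ofReal hplus
      (Filter.Eventually.of_forall fun _ => lpSq_nonneg _),
    ← ofReal_integral_eq_lintegral_ofReal hV (Filter.Eventually.of_forall fun _ => lpSq_nonneg _),
    ← ENNReal.ofReal_mul hc, ← ENNReal.ofReal_add (lpSq_nonneg _)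
      (mul_nonneg hc (integral_nonneg fun _ => lpSq_nonneg _))]
  exact ENNReal.ofReal_le_ofReal hmain

/-- The Nemirovski inequality for sums of conditionally independent centred vectors. -/
lemma lintegral_lpSq_sum_le [IsProbabilityMeasure μ] [IsProbabilityMeasure P] {r : ℕ} (hr : 1 ≤ r)
    {ℱ : ℕ → MeasurableSpace Ω} (hle : ∀ n, ℱ n ≤ mΩ) (hmono : Monotone ℱ)
    {ξ : ℕ → Ω → Ξ} (hξ : ∀ n, Measurable[ℱ (n + 1)] (ξ n)) (hlaw : ∀ n, μ.map (ξ n) = P)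
    (hind : ∀ n, Indep (ℱ n) (mΞ.comap (ξ n)) μ)
    {w : Ω → β} (hw : Measurable[ℱ 0] w) {E : Ω → Vec d} (hE : Measurable[ℱ 0] E)
    {H : β → Ξ → Vec d} (hH : Measurable (Function.uncurry H))
    (hint : ∀ ω, Integrable (H (w ω)) P) (hV : ∀ ω, Integrable (fun z => lpSq r (H (w ω) z)) P)
    (h0 : ∀ ω, ∫ z, H (w ω) z ∂P = 0) (n : ℕ) :
    ∫⁻ ω, ENNReal.ofReal (lpSq r (E ω + ∑ i ∈ Finset.range n, H (w ω) (ξ i ω))) ∂μ ≤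
      ∫⁻ ω, ENNReal.ofReal (lpSq r (E ω)) ∂μ + n * (ENNReal.ofReal (2 * (4 * r - 3)) *
        ∫⁻ ω, ∫⁻ z, ENNReal.ofReal (lpSq r (H (w ω) z)) ∂P ∂μ) := by
  have hr' : (1 : ℝ) ≤ r := by exact_mod_cast hr
  have hVm : Measurable fun y : Vec d => ENNReal.ofReal (lpSq r y) :=
    (continuous_lpSq hr').measurable.ennreal_ofReal
  have hEn : ∀ n, Measurable[ℱ n] fun ω => E ω + ∑ i ∈ Finset.range n, H (w ω) (ξ i ω) := by
    intro n
    refine Measurable.add (hE.mono (hmono n.zero_le) le_rfl)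
      (Finset.measurable_sum _ fun i hi => ?_)
    have hi' : i + 1 ≤ n := Finset.mem_range.1 hi
    exact hH.comp (Measurable.prodMk (hw.mono (hmono n.zero_le) le_rfl)
      ((hξ i).mono (hmono hi') le_rfl))
  induction n with
  | zero => simp
  | succ n ih =>
    -- Pairing the partial sum with `w` collects all that the next summand depends on, apart from
    -- the fresh sample, in one `ℱ n`-measurable variable. The fresh sample can then be integrated
    -- out first.
    have hU : Measurable[ℱ n] fun ω => (E ω + ∑ i ∈ Finset.range n, H (w ω) (ξ i ω), w ω) :=
      (hEn n).prodMk (hw.mono (hmono n.zero_le) le_rfl)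
    have hindf : IndepFun (fun ω => (E ω + ∑ i ∈ Finset.range n, H (w ω) (ξ i ω), w ω)) (ξ n) μ :=
      indep_of_indep_of_le_left (hind n) hU.comap_le
    have hφ : Measurable fun p : (Vec d × β) × Ξ =>
        ENNReal.ofReal (lpSq r (p.1.1 + H p.1.2 p.2)) :=
      hVm.comp (Measurable.add (measurable_fst.comp measurable_fst)
        (hH.comp ((measurable_snd.comp measurable_fst).prodMk measurable_snd)))
    have hξn : Measurable (ξ n) := (hξ n).mono (hle _) le_rfl
    have key := lintegral_comp_of_indepFun (hU.mono (hle n) le_rfl) hξn hindf (hlaw n) hφ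
    have hmeas : Measurable fun ω => ENNReal.ofReal (lpSq r
        (E ω + ∑ i ∈ Finset.range n, H (w ω) (ξ i ω))) := hVm.comp ((hEn n).mono (hle n) le_rfl)
    calc ∫⁻ ω, ENNReal.ofReal (lpSq r (E ω + ∑ i ∈ Finset.range (n + 1), H (w ω) (ξ i ω))) ∂μ
        = ∫⁻ ω, ∫⁻ z, ENNReal.ofReal (lpSq r ((E ω + ∑ i ∈ Finset.range n, H (w ω) (ξ i ω))
            + H (w ω) z)) ∂P ∂μ := by
          rw [← key]; simp only [Finset.sum_range_succ, add_assoc]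
      _ ≤ ∫⁻ ω, (ENNReal.ofReal (lpSq r (E ω + ∑ i ∈ Finset.range n, H (w ω) (ξ i ω))) +
            ENNReal.ofReal (2 * (4 * r - 3)) *
              ∫⁻ z, ENNReal.ofReal (lpSq r (H (w ω) z)) ∂P) ∂μ :=
          lintegral_mono fun ω => lintegral_lpSq_const_add_le hr _ (hint ω) (hV ω) (h0 ω)
      _ = ∫⁻ ω, ENNReal.ofReal (lpSq r (E ω + ∑ i ∈ Finset.range n, H (w ω) (ξ i ω))) ∂μ +
            ENNReal.ofReal (2 * (4 * r - 3)) *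
              ∫⁻ ω, ∫⁻ z, ENNReal.ofReal (lpSq r (H (w ω) z)) ∂P ∂μ := by
          rw [lintegral_add_left hmeas, lintegral_const_mul' _ _ ENNReal.ofReal_ne_top]
      _ ≤ _ := by
          rw [Nat.cast_add_one, add_mul, one_mul, ← add_assoc]
          gcongr

end Martingale

/-! ### The history of a run -/

section History

variable {Ω Ξ α : Type*} [mΞ : MeasurableSpace Ξ] [mα : MeasurableSpace α]

lemma indepFun_prodMk_left {mΩ : MeasurableSpace Ω} {μ : Measure Ω} {A B C : Type*}
    [MeasurableSpace A] [MeasurableSpace B]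
    [MeasurableSpace C] [IsProbabilityMeasure μ] {f : Ω → A} {g : Ω → B} {h : Ω → C}
    (hf : Measurable f) (hg : Measurable g) (hh : Measurable h)
    (h1 : IndepFun f (fun ω => (g ω, h ω)) μ) (h2 : IndepFun g h μ) :
    IndepFun (fun ω => (f ω, g ω)) h μ := by
  have := Measure.isProbabilityMeasure_map (μ := μ) hf.aemeasurable
  have := Measure.isProbabilityMeasure_map (μ := μ) hg.aemeasurable
  have := Measure.isProbabilityMeasure_map (μ := μ) hh.aemeasurable
  have hfg : IndepFun f g μ := h1.comp measurable_id measurable_fst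
  rw [indepFun_iff_map_prod_eq_prod_map_map (by fun_prop) (by fun_prop)] at h1 h2 hfg ⊢
  rw [h2] at h1
  rw [hfg]
  have e : (fun ω => ((f ω, g ω), h ω))
      = MeasurableEquiv.prodAssoc.symm ∘ fun ω => (f ω, (g ω, h ω)) := rfl
  rw [e, ← Measure.map_map (MeasurableEquiv.measurable _) (by fun_prop), h1]
  exact ((measurePreserving_prodAssoc (μ.map f) (μ.map g) (μ.map h)).symm _).map_eq

/-- The information carried by the initial point and the samples with index in `S`. -/
@[reducible] def history (x₁ : Ω → α) (ζ : ℕ → ℕ → Ω → Ξ) (S : Set (ℕ × ℕ)) : MeasurableSpace Ω :=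
  MeasurableSpace.comap (fun ω => (x₁ ω, fun s : S => ζ s.1.1 s.1.2 ω)) inferInstance

variable {x₁ : Ω → α} {ζ : ℕ → ℕ → Ω → Ξ}

lemma measurable_history_init (S : Set (ℕ × ℕ)) : Measurable[history x₁ ζ S] x₁ :=
  measurable_fst.comp (comap_measurable (fun ω => (x₁ ω, fun s : S => ζ s.1.1 s.1.2 ω)))

lemma measurable_history_sample {S : Set (ℕ × ℕ)} {k i : ℕ} (h : (k, i) ∈ S) :
    Measurable[history x₁ ζ S] (ζ k i) :=
  ((measurable_pi_apply (⟨(k, i), h⟩ : S)).comp measurable_snd).comp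
    (comap_measurable (fun ω => (x₁ ω, fun s : S => ζ s.1.1 s.1.2 ω)))

lemma history_mono {S T : Set (ℕ × ℕ)} (h : S ⊆ T) : history x₁ ζ S ≤ history x₁ ζ T := by
  have hπ : Measurable fun u : α × (T → Ξ) => (u.1, fun s : S => u.2 ⟨s.1, h s.2⟩) := by fun_prop
  exact (hπ.comp (comap_measurable (fun ω => (x₁ ω, fun s : T => ζ s.1.1 s.1.2 ω)))).comap_le

lemma history_le {mΩ : MeasurableSpace Ω} (hx : Measurable x₁) (hζ : ∀ k i, Measurable (ζ k i))
    (S : Set (ℕ × ℕ)) : history x₁ ζ S ≤ mΩ := by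
  have : Measurable fun ω => (x₁ ω, fun s : S => ζ s.1.1 s.1.2 ω) :=
    hx.prodMk (measurable_pi_lambda _ fun s => hζ _ _)
  exact this.comap_le

lemma history_le_comap (S : Set (ℕ × ℕ)) : history x₁ ζ S ≤
    MeasurableSpace.comap (fun ω => (x₁ ω, fun p : ℕ × ℕ => ζ p.1 p.2 ω)) inferInstance := by
  have hπ : Measurable fun u : α × (ℕ × ℕ → Ξ) => (u.1, fun s : S => u.2 s.1) := by fun_prop
  exact (hπ.comp (comap_measurable (fun ω => (x₁ ω, fun p : ℕ × ℕ => ζ p.1 p.2 ω)))).comap_le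

/-- The initial point is independent of all samples jointly, and the samples indexed by `S` are
independent of one outside `S`; the two facts combine because the joint law of the triple is a
product. -/
lemma indep_history_sample {mΩ : MeasurableSpace Ω} {μ : Measure Ω}
    [IsProbabilityMeasure μ] (hx : Measurable x₁)
    (hζ : ∀ k i, Measurable (ζ k i)) (hind : iIndepFun (fun p : ℕ × ℕ => ζ p.1 p.2) μ)
    (hinit : IndepFun x₁ (fun ω => fun p : ℕ × ℕ => ζ p.1 p.2 ω) μ)
    {S : Set (ℕ × ℕ)} {k i : ℕ} (h : (k, i) ∉ S) :
    Indep (history x₁ ζ S) (mΞ.comap (ζ k i)) μ := by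
  have hS : Measurable fun ω => fun s : S => ζ s.1.1 s.1.2 ω :=
    measurable_pi_lambda _ fun s => hζ _ _
  refine indepFun_prodMk_left hx hS (hζ k i) ?_ ?_
  · exact hinit.comp (φ := id) (ψ := fun Z => (fun s : S => Z s.1, Z (k, i))) measurable_id
      (by fun_prop)
  · have h1 := indep_iSup_of_disjoint (m := fun p : ℕ × ℕ => mΞ.comap (ζ p.1 p.2))
      (fun p => (hζ p.1 p.2).comap_le) hind (S := S) (T := {(k, i)})
      (Set.disjoint_singleton_right.2 h)
    refine indep_of_indep_of_le_left (indep_of_indep_of_le_right h1 ?_) ?_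
    · simp
    · refine Measurable.comap_le (@measurable_pi_lambda _ _ _ (_) _ _ fun s => ?_)
      refine (comap_measurable (ζ s.1.1 s.1.2)).mono ?_ le_rfl
      exact le_iSup₂_of_le (f := fun (p : ℕ × ℕ) (_ : p ∈ S) => mΞ.comap (ζ p.1 p.2)) s.1 s.2 le_rfl

end History


/-! ### The stationarity residual of a constrained differentiable function -/

section Residual

variable {X : Set (Vec d)} {f : Vec d → ℝ}

lemma nonneg_of_forall_nonneg_add_mul {b c : ℝ} (h : ∀ s : ℝ, 0 < s → s ≤ 1 → 0 ≤ b + s * c) :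
    0 ≤ b := by
  have ht : Filter.Tendsto (fun s : ℝ => b + s * c) (𝓝[>] 0) (𝓝 b) := by
    have : Filter.Tendsto (fun s : ℝ => b + s * c) (𝓝 0) (𝓝 (b + 0 * c)) :=
      (Continuous.tendsto (by fun_prop) 0)
    rw [zero_mul, add_zero] at this
    exact this.mono_left nhdsWithin_le_nhds
  refine ge_of_tendsto ht ?_
  filter_upwards [Ioc_mem_nhdsGT (zero_lt_one (α := ℝ))] with s hs
  exact h s hs.1 hs.2

lemma segment_mem (hX : Convex ℝ X) {x y : Vec d} (hx : x ∈ X) (hy : y ∈ X) {s : ℝ} (h0 : 0 ≤ s)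
    (h1 : s ≤ 1) : x + s • (y - x) ∈ X :=
  hX.add_smul_sub_mem hx hy ⟨h0, h1⟩

/-- This is `∂(f + δ_X) = ∇f + N_X`. By convexity the segment from `x` to `y` stays in `X`; testing
the subgradient inequality at a small step and dividing by the step makes the local condition
global. Conversely, first-order expansion handles points of `X`, and points off `X` have value `+∞`.
-/
lemma mem_subdifferential_iff (hX : Convex ℝ X) {x v : Vec d} (hx : x ∈ X)
    (hf : DifferentiableAt ℝ f x) :
    v ∈ subdifferential (fun y => (f y : EReal) + convexIndicator X y) x ↔
      ∀ y ∈ X, inner ℝ (v - gradient f x) (y - x) ≤ (0 : ℝ) := by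
  have hval : ∀ y ∈ X, (f y : EReal) + convexIndicator X y = (f y : EReal) := fun y hy => by
    simp [convexIndicator, hy]
  have hgrad := hasGradientAt_iff_isLittleO.1 hf.hasGradientAt
  constructor
  · rintro ⟨-, -, h⟩ y hy
    have key : ∀ ε : ℝ, 0 < ε → inner ℝ (v - gradient f x) (y - x) ≤ ε * ‖y - x‖ := by
      intro ε hε
      have h1 := h (ε / 2) (by positivity)
      have h2 := hgrad.def (show 0 < ε / 2 by positivity)
      have ht : Filter.Tendsto (fun s : ℝ => x + s • (y - x)) (𝓝[>] 0) (𝓝 x) := by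
        have : Filter.Tendsto (fun s : ℝ => x + s • (y - x)) (𝓝 0) (𝓝 (x + (0 : ℝ) • (y - x))) :=
          Continuous.tendsto (by fun_prop) 0
        rw [zero_smul, add_zero] at this
        exact this.mono_left nhdsWithin_le_nhds
      obtain ⟨s, ⟨h1s, h2s⟩, hs0, hs1⟩ := ((ht.eventually (h1.and h2)).and
        (Ioc_mem_nhdsGT (zero_lt_one (α := ℝ)))).exists
      beta_reduce at h1s
      rw [hval x hx, hval _ (segment_mem hX hx hy hs0.le hs1), add_sub_cancel_left,
        ← EReal.coe_add, EReal.coe_le_coe_iff] at h1s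
      rw [add_sub_cancel_left, Real.norm_eq_abs] at h2s
      have h3 := (abs_le.1 h2s).2
      rw [norm_smul, Real.norm_of_nonneg hs0.le] at h1s h3
      rw [inner_smul_right] at h1s h3
      rw [inner_sub_left]
      have h4 : s * (inner ℝ v (y - x) - inner ℝ (gradient f x) (y - x)) ≤ s * (ε * ‖y - x‖) := by
        linarith
      exact le_of_mul_le_mul_left h4 hs0
    by_contra! hcon
    -- This `ε` makes `ε‖y - x‖` smaller than the supposedly positive inner product; the `+ 1`
    -- avoids division by zero at `y = x`.
    have := key (inner ℝ (v - gradient f x) (y - x) / (2 * (‖y - x‖ + 1))) (by positivity)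
    rw [div_mul_eq_mul_div, le_div_iff₀ (by positivity)] at this
    nlinarith [norm_nonneg (y - x)]
  · intro h
    refine ⟨by simp [hval x hx], by simp [hval x hx], fun ε hε => ?_⟩
    filter_upwards [hgrad.def hε] with y hy
    by_cases hyX : y ∈ X
    · rw [hval x hx, hval y hyX, ← EReal.coe_add, EReal.coe_le_coe_iff]
      have h1 := (abs_le.1 ((Real.norm_eq_abs _).symm.le.trans hy)).1
      have h2 := h y hyX
      rw [inner_sub_left] at h2
      linarith
    · simp [convexIndicator, hyX]

/-- `∇f` is `L`-Lipschitz on `X` from `ℓ₁` to `ℓ_∞`. -/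
def LipschitzGradientOn (X : Set (Vec d)) (f : Vec d → ℝ) (L : ℝ) : Prop :=
  ∀ x ∈ X, ∀ y ∈ X, linfNorm (gradient f x - gradient f y) ≤ L * l1Norm (x - y)

lemma l1Norm_le_mul_linfNorm (x : Vec d) : l1Norm x ≤ d * linfNorm x := by
  simpa [l1Norm] using Finset.sum_le_sum fun i (_ : i ∈ Finset.univ) => abs_le_linfNorm x i

lemma LipschitzGradientOn.continuous {L : ℝ} (hL : 0 ≤ L) (h : LipschitzGradientOn X f L) :
    Continuous fun x : X => gradient f (x : Vec d) := by
  refine (LipschitzWith.of_dist_le_mul (K := (d * (L * d)).toNNReal) fun x y => ?_).continuous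
  rw [dist_eq_norm, Subtype.dist_eq, dist_eq_norm]
  calc _ ≤ l1Norm _ := norm_le_l1Norm _
    _ ≤ d * linfNorm _ := l1Norm_le_mul_linfNorm _
    _ ≤ d * (L * l1Norm ((x : Vec d) - (y : Vec d))) := by gcongr; exact h x x.2 y y.2
    _ ≤ d * (L * (d * ‖(x : Vec d) - (y : Vec d)‖)) := by gcongr; exact l1Norm_le_mul_norm _
    _ = _ := by rw [Real.coe_toNNReal _ (by positivity)]; ring

lemma isCompact_linfNorm_le (r : ℝ) : IsCompact {v : Vec d | linfNorm v ≤ r} := by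
  refine Metric.isCompact_of_isClosed_isBounded
    (isClosed_le continuous_linfNorm continuous_const) ?_
  refine (Metric.isBounded_iff_subset_closedBall 0).2 ⟨d * r, fun v hv => ?_⟩
  rw [mem_closedBall_zero_iff]
  exact (norm_le_l1Norm v).trans ((l1Norm_le_mul_linfNorm v).trans
    (mul_le_mul_of_nonneg_left hv d.cast_nonneg))

/-- For fixed `r`, the points having a subgradient with `‖v‖_∞ ≤ r` form the projection of a closed
set along a compact ball, hence a closed set. Strict sublevel sets of the residual are countable
unions of these over rational `r`. -/
lemma measurable_residual {L : ℝ} (hL : 0 ≤ L) (hX : Convex ℝ X) (hf : Differentiable ℝ f)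
    (h : LipschitzGradientOn X f L) : Measurable fun x : X => residual f X (x : Vec d) := by
  have hclosed : ∀ r : ℝ, IsClosed {x : X | ∃ v : Vec d, linfNorm v ≤ r ∧
      ∀ y ∈ X, inner ℝ (v - gradient f (x : Vec d)) (y - x) ≤ (0 : ℝ)} := by
    intro r
    have : CompactSpace {v : Vec d | linfNorm v ≤ r} :=
      isCompact_iff_compactSpace.1 (isCompact_linfNorm_le r)
    have hC : IsClosed {p : X × {v : Vec d | linfNorm v ≤ r} |
        ∀ y ∈ X, inner ℝ ((p.2 : Vec d) - gradient f (p.1 : Vec d)) (y - p.1) ≤ (0 : ℝ)} := by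
      simp only [Set.ofPred_forall]
      refine isClosed_iInter fun y => isClosed_iInter fun _ => isClosed_le ?_ continuous_const
      have hg := (h.continuous hL).comp (continuous_fst (X := X)
        (Y := {v : Vec d | linfNorm v ≤ r}))
      simp only [Function.comp_def] at hg
      fun_prop
    convert isClosedMap_fst_of_compactSpace _ hC using 1
    ext x
    constructor
    · rintro ⟨v, hv, hx⟩; exact ⟨(x, ⟨v, hv⟩), hx, rfl⟩
    · rintro ⟨⟨x', v⟩, hx, rfl⟩; exact ⟨v, v.2, hx⟩
  refine measurable_of_Iio fun a => ?_
  have : (fun x : X => residual f X (x : Vec d)) ⁻¹' Set.Iio a =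
      ⋃ r : {r : ℚ // ENNReal.ofReal r < a}, {x : X | ∃ v : Vec d, linfNorm v ≤ (r : ℚ) ∧
        ∀ y ∈ X, inner ℝ (v - gradient f (x : Vec d)) (y - x) ≤ (0 : ℝ)} := by
    ext x
    simp only [Set.mem_preimage, Set.mem_Iio, residual, iInf_lt_iff, Set.mem_iUnion,
      Set.mem_ofPred_eq, mem_subdifferential_iff hX x.2 (hf _), exists_prop]
    constructor
    · rintro ⟨v, hv, hva⟩
      obtain ⟨q, hq0, hq1, hq2⟩ := ENNReal.lt_iff_exists_rat_btwn.1 hva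
      refine ⟨⟨q, hq2⟩, v, ?_, hv⟩
      exact ((ENNReal.ofReal_lt_ofReal_iff_of_nonneg (linfNorm_nonneg v)).1 hq1).le
    · rintro ⟨q, v, hvq, hv⟩
      exact ⟨v, hv, (ENNReal.ofReal_le_ofReal hvq).trans_lt q.2⟩
  rw [this]
  exact MeasurableSet.iUnion fun r => (hclosed _).measurableSet

/-- Along the segment, `f` minus its linear part minus the quadratic bound has nonpositive
derivative, by `ℓ₁`/`ℓ_∞` duality and the Lipschitz condition. -/
lemma LipschitzGradientOn.le_quadratic {L : ℝ} (hX : Convex ℝ X)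
    (hf : Differentiable ℝ f) (h : LipschitzGradientOn X f L) {x y : Vec d} (hx : x ∈ X)
    (hy : y ∈ X) :
    f y ≤ f x + inner ℝ (gradient f x) (y - x) + L / 2 * l1Norm (y - x) ^ 2 := by
  set N := l1Norm (y - x)
  set φ : ℝ → ℝ := fun s =>
    f (x + s • (y - x)) - s * inner ℝ (gradient f x) (y - x) - s ^ 2 * (L / 2 * N ^ 2)
  have hline : ∀ s : ℝ, HasDerivAt (fun s : ℝ => x + s • (y - x)) (y - x) s := fun s => by
    simpa using ((hasDerivAt_id s).smul_const (y - x)).const_add x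
  have hder : ∀ s : ℝ, HasDerivAt φ (inner ℝ (gradient f (x + s • (y - x))) (y - x)
      - 1 * inner ℝ (gradient f x) (y - x) - (2 * s) * (L / 2 * N ^ 2)) s := fun s => by
    have h1 := ((hf (x + s • (y - x))).hasGradientAt.hasFDerivAt).comp_hasDerivAt s (hline s)
    rw [InnerProductSpace.toDual_apply_apply] at h1
    have h2 := (hasDerivAt_pow 2 s).mul_const (L / 2 * N ^ 2)
    simp only [Nat.cast_ofNat, Nat.add_one_sub_one, pow_one] at h2
    exact (h1.sub ((hasDerivAt_id s).mul_const _)).sub h2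
  have hanti : AntitoneOn φ (Set.Icc 0 1) := by
    refine antitoneOn_of_deriv_nonpos (convex_Icc 0 1)
      (fun s _ => (hder s).continuousAt.continuousWithinAt)
      (fun s _ => (hder s).differentiableAt.differentiableWithinAt) fun s hs => ?_
    rw [interior_Icc] at hs
    rw [(hder s).deriv, one_mul, ← inner_sub_left]
    have h1 := (le_abs_self _).trans
      (abs_inner_le (gradient f (x + s • (y - x)) - gradient f x) (y - x))
    have h2 := h _ (segment_mem hX hx hy hs.1.le hs.2.le) x hx
    rw [add_sub_cancel_left, l1Norm_smul, abs_of_pos hs.1] at h2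
    have h3 := mul_le_mul_of_nonneg_right h2 (l1Norm_nonneg (y - x))
    simp only [N]
    nlinarith
  have := hanti (Set.left_mem_Icc.2 zero_le_one) (Set.right_mem_Icc.2 zero_le_one) zero_le_one
  simp only [φ, one_smul, zero_smul, add_zero, add_sub_cancel] at this
  linarith

end Residual

/-! ### The proximal step -/

section Prox

variable {X : Set (Vec d)} {ρ : ℝ}

/-- A sum rule for the nonsmooth term: `w` is a subgradient of `R‖·‖₁` at `0`. It comes from
separating the strict epigraph of `R‖·‖₁` from the part of the hypograph of `-⟨a, ·⟩` lying over `X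
- x'`; the hypothesis says exactly that the two are disjoint. -/
lemma exists_linfNorm_le_inner_add_nonneg (hX : Convex ℝ X) {x' a : Vec d} (hx' : x' ∈ X) {R : ℝ}
    (hR : 0 ≤ R) (h : ∀ y ∈ X, 0 ≤ inner ℝ a (y - x') + R * l1Norm (y - x')) :
    ∃ w : Vec d, linfNorm w ≤ R ∧ ∀ y ∈ X, (0 : ℝ) ≤ inner ℝ (a + w) (y - x') := by
  set s : Set (Vec d × ℝ) := {p | R * l1Norm p.1 < p.2}
  set T : Set (Vec d × ℝ) := {p | x' + p.1 ∈ X ∧ p.2 ≤ -inner ℝ a p.1}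
  have hs : Convex ℝ s := by
    rintro ⟨z₁, t₁⟩ h₁ ⟨z₂, t₂⟩ h₂ α β hα hβ hαβ
    simp only [s, Set.mem_ofPred_eq, Prod.smul_mk, Prod.mk_add_mk, smul_eq_mul] at h₁ h₂ ⊢
    have h3 := mul_le_mul_of_nonneg_left (l1Norm_add_le (α • z₁) (β • z₂)) hR
    rw [l1Norm_smul, l1Norm_smul, abs_of_nonneg hα, abs_of_nonneg hβ] at h3
    rcases hα.eq_or_lt with rfl | hα'
    · have hβ1 : β = 1 := by linarith
      subst hβ1
      linarith
    · nlinarith [mul_lt_mul_of_pos_left h₁ hα', mul_le_mul_of_nonneg_left h₂.le hβ]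
  have hso : IsOpen s :=
    isOpen_lt (continuous_const.mul (continuous_l1Norm.comp continuous_fst)) continuous_snd
  have hT : Convex ℝ T := by
    rintro ⟨z₁, t₁⟩ ⟨h₁, h₁'⟩ ⟨z₂, t₂⟩ ⟨h₂, h₂'⟩ α β hα hβ hαβ
    refine ⟨?_, ?_⟩
    · have := hX h₁ h₂ hα hβ hαβ
      have e : x' + (α • (z₁, t₁) + β • (z₂, t₂)).1 = α • (x' + z₁) + β • (x' + z₂) := by
        simp only [Prod.smul_mk, Prod.mk_add_mk, smul_add]
        nth_rewrite 1 [← one_smul ℝ x', ← hαβ, add_smul]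
        abel
      rw [e]; exact this
    · simp only [Prod.smul_mk, Prod.mk_add_mk, smul_eq_mul, inner_add_right,
        inner_smul_right] at h₁' h₂' ⊢
      nlinarith [mul_le_mul_of_nonneg_left h₁' hα, mul_le_mul_of_nonneg_left h₂' hβ]
  have hdisj : Disjoint s T := by
    rw [Set.disjoint_left]
    rintro ⟨z, t⟩ h₁ ⟨h₂, h₃⟩
    have := h _ h₂
    rw [add_sub_cancel_left] at this
    simp only [s, Set.mem_ofPred_eq] at h₁ h₃
    linarith
  obtain ⟨g, u, hgs, hgT⟩ := geometric_hahn_banach_open hs hso hT hdisj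
  set c := g (0, 1)
  have hg : ∀ z t, g (z, t) = g (z, 0) + t * c := fun z t => by
    have : ((z, t) : Vec d × ℝ) = (z, 0) + t • (0, 1) := by simp
    rw [this, map_add, map_smul, smul_eq_mul]
  have hu : u ≤ 0 := by
    have := hgT (0, 0) ⟨by simpa using hx', by simp⟩
    rwa [show ((0, 0) : Vec d × ℝ) = 0 from rfl, map_zero] at this
  have hpos : ∀ t : ℝ, 0 < t → t * c < u := fun t ht => by
    have := hgs (0, t) (by simpa [s, l1Norm_zero] using ht)
    rwa [hg, show ((0, 0) : Vec d × ℝ) = 0 from rfl, map_zero, zero_add] at this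
  -- The hyperplane is not vertical, so dividing by `-c` gives a linear functional below `R‖·‖₁`.
  -- Its values at `±e_i` bound the coordinates of `w`.
  have hc : 0 < -c := by linarith [hpos 1 one_pos]
  have hu0 : 0 ≤ u := nonneg_of_forall_nonneg_add_mul (c := -c) fun t ht _ => by
    linarith [hpos t ht]
  have hub : ∀ z, g (z, 0) ≤ -c * (R * l1Norm z) := fun z => by
    have : 0 ≤ -c * (R * l1Norm z) - g (z, 0) :=
      nonneg_of_forall_nonneg_add_mul (c := -c) fun t ht _ => by
        have := hgs (z, R * l1Norm z + t) (by simpa [s] using ht)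
        rw [hg] at this
        linarith
    linarith
  set ℓ : StrongDual ℝ (Vec d) := (-c)⁻¹ • g.comp (ContinuousLinearMap.inl ℝ (Vec d) ℝ)
  have hℓ : ∀ z, ℓ z = (-c)⁻¹ * g (z, 0) := fun z => rfl
  have hℓR : ∀ z, ℓ z ≤ R * l1Norm z := fun z => by
    rw [hℓ, inv_mul_le_iff₀ hc]; exact hub z
  refine ⟨(InnerProductSpace.toDual ℝ (Vec d)).symm ℓ, linfNorm_le hR fun i => ?_, fun y hy => ?_⟩
  · have hwi : ∀ e : ℝ, ℓ (EuclideanSpace.single i e)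
        = e * ((InnerProductSpace.toDual ℝ (Vec d)).symm ℓ) i := fun e => by
      rw [← InnerProductSpace.toDual_symm_apply, EuclideanSpace.inner_single_right]
      simp
    have hn : ∀ e : ℝ, l1Norm (EuclideanSpace.single i e : Vec d) = |e| := fun e => by
      simp [l1Norm, PiLp.single_apply, apply_ite abs]
    have h1 := hℓR (EuclideanSpace.single i 1)
    have h2 := hℓR (EuclideanSpace.single i (-1))
    rw [hwi, hn] at h1 h2
    norm_num at h1 h2
    exact abs_le.2 ⟨by linarith, h1⟩
  · rw [inner_add_left, InnerProductSpace.toDual_symm_apply, hℓ]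
    have h1 := hgT (y - x', -inner ℝ a (y - x')) ⟨by simpa using hy, le_rfl⟩
    rw [hg] at h1
    have h2 : inner ℝ a (y - x') * -c + g (y - x', 0) ≥ 0 := by linarith
    have h3 : inner ℝ a (y - x') + (-c)⁻¹ * g (y - x', 0)
        = (-c)⁻¹ * (inner ℝ a (y - x') * -c + g (y - x', 0)) := by
      rw [mul_add, mul_comm _ (-c), inv_mul_cancel_left₀ hc.ne']
    rw [h3]
    positivity

/-- Compare `x'` with `x' + s(y - x')`, divide by `s` and let `s → 0`. The `ℓ₁` norm is not
differentiable, but by the triangle inequality its square is at most `(‖x' - x‖₁ + s‖y - x'‖₁)²`,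
whose linear term gives the factor `ρ`. -/
lemma IsProxPoint.inner_add_nonneg (hX : Convex ℝ X) (hρ : 0 ≤ ρ) {x v x' : Vec d}
    (h : IsProxPoint X (proxTerm ρ) x v x') {y : Vec d} (hy : y ∈ X) :
    0 ≤ inner ℝ (x' - v) (y - x') + ρ * l1Norm (x' - x) * l1Norm (y - x') := by
  refine nonneg_of_forall_nonneg_add_mul
    (c := 1 / 2 * ‖y - x'‖ ^ 2 + ρ / 2 * l1Norm (y - x') ^ 2) fun s hs0 hs1 => ?_
  have h1 := h.2 (segment_mem hX h.1 hy hs0.le hs1)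
  simp only [proxTerm, Set.mem_ofPred_eq] at h1
  have e1 : x' + s • (y - x') - v = (x' - v) + s • (y - x') := by abel
  have e2 : x' + s • (y - x') - x = (x' - x) + s • (y - x') := by abel
  have h2 := l1Norm_add_le (x' - x) (s • (y - x'))
  rw [l1Norm_smul, abs_of_pos hs0] at h2
  have h3 : l1Norm ((x' - x) + s • (y - x')) ^ 2 ≤ (l1Norm (x' - x) + s * l1Norm (y - x')) ^ 2 :=
    pow_le_pow_left₀ (l1Norm_nonneg _) h2 2
  rw [e1, e2, norm_add_sq_real, inner_smul_right, norm_smul, Real.norm_of_nonneg hs0.le] at h1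
  have h4 := mul_le_mul_of_nonneg_left h3 (show 0 ≤ ρ / 2 by positivity)
  have h5 : 0 ≤ s * (inner ℝ (x' - v) (y - x') + ρ * l1Norm (x' - x) * l1Norm (y - x')
      + s * (1 / 2 * ‖y - x'‖ ^ 2 + ρ / 2 * l1Norm (y - x') ^ 2)) := by linarith
  exact nonneg_of_mul_nonneg_right h5 hs0

/-- The residual after a proximal gradient step. -/
lemma residual_le_of_isProxPoint {f : Vec d → ℝ} {L η : ℝ} (hX : Convex ℝ X)
    (hf : Differentiable ℝ f) (hlip : LipschitzGradientOn X f L) (hρ : 0 ≤ ρ) (hη : 0 < η)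
    {x g x' : Vec d} (hx : x ∈ X) (h : IsProxPoint X (proxTerm ρ) x (x - η • g) x') :
    residual f X x' ≤ ENNReal.ofReal
      ((L + (ρ + 1) / η) * l1Norm (x' - x) + linfNorm (g - gradient f x)) := by
  obtain ⟨w, hw, hopt⟩ := exists_linfNorm_le_inner_add_nonneg hX h.1
    (mul_nonneg hρ (l1Norm_nonneg (x' - x))) fun y hy => h.inner_add_nonneg hX hρ hy
  -- The variational inequality puts `n` in the normal cone at `x'`. In `∇f(x') + n` the `g` from
  -- the gradient step pairs with `∇f(x)`, leaving a Lipschitz difference, the estimation error and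
  -- `(x' - x + w)/η`.
  set n : Vec d := -(η⁻¹ • (x' - (x - η • g) + w))
  have hmem : gradient f x' + n ∈
      subdifferential (fun y => (f y : EReal) + convexIndicator X y) x' := by
    rw [mem_subdifferential_iff hX h.1 (hf _)]
    intro y hy
    rw [add_sub_cancel_left, inner_neg_left, real_inner_smul_left]
    have := mul_nonneg (inv_nonneg.2 hη.le) (hopt y hy)
    linarith
  refine (iInf₂_le _ hmem).trans (ENNReal.ofReal_le_ofReal ?_)
  have e : gradient f x' + n = (gradient f x' - gradient f x)
      - (g - gradient f x) - η⁻¹ • ((x' - x) + w) := by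
    have : η⁻¹ • (η • g) = g := by rw [smul_smul, inv_mul_cancel₀ hη.ne', one_smul]
    simp only [n, smul_add, smul_sub, this]
    abel
  have h1 := linfNorm_sub_le ((gradient f x' - gradient f x) - (g - gradient f x))
    (η⁻¹ • ((x' - x) + w))
  have h2 := linfNorm_sub_le (gradient f x' - gradient f x) (g - gradient f x)
  have h3 := hlip x' h.1 x hx
  have h4 := linfNorm_add_le (x' - x) w
  have h5 := linfNorm_le_l1Norm (x' - x)
  rw [linfNorm_smul, abs_of_pos (inv_pos.2 hη)] at h1
  have h6 : η⁻¹ * linfNorm (x' - x + w) ≤ η⁻¹ * (l1Norm (x' - x) + ρ * l1Norm (x' - x)) := by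
    gcongr; linarith
  rw [e]
  calc _ ≤ L * l1Norm (x' - x) + linfNorm (g - gradient f x)
        + η⁻¹ * (l1Norm (x' - x) + ρ * l1Norm (x' - x)) := by linarith
    _ = _ := by field_simp; ring

/-- The decrease of the objective in a proximal gradient step. -/
lemma descent_of_isProxPoint {f : Vec d → ℝ} {L η : ℝ} (hX : Convex ℝ X)
    (hf : Differentiable ℝ f) (hlip : LipschitzGradientOn X f L) (hρ : 0 < ρ) (hη : 0 < η)
    {x g x' : Vec d} (hx : x ∈ X) (h : IsProxPoint X (proxTerm ρ) x (x - η • g) x') :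
    (ρ / (4 * η) - L / 2) * l1Norm (x' - x) ^ 2 + f x' ≤
      f x + η / ρ * linfNorm (g - gradient f x) ^ 2 := by
  have h1 := hlip.le_quadratic hX hf hx h.1
  have h2 := h.2 hx
  simp only [proxTerm, Set.mem_ofPred_eq, sub_self, l1Norm_zero] at h2
  rw [show x' - (x - η • g) = (x' - x) + η • g by abel, sub_sub_cancel, norm_add_sq_real,
    inner_smul_right] at h2
  have h3 : η * inner ℝ (x' - x) g + ρ / 2 * l1Norm (x' - x) ^ 2 ≤ 0 := by
    nlinarith [sq_nonneg ‖x' - x‖]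
  have h4 := (neg_abs_le _).trans' (neg_le_neg (abs_inner_le (g - gradient f x) (x' - x)))
  rw [inner_sub_left, real_inner_comm] at h4
  set N := l1Norm (x' - x)
  set e := linfNorm (g - gradient f x)
  have h5 : inner ℝ (x' - x) g + ρ / (2 * η) * N ^ 2 ≤ 0 := by
    have : η * (inner ℝ (x' - x) g + ρ / (2 * η) * N ^ 2)
        = η * inner ℝ (x' - x) g + ρ / 2 * N ^ 2 := by field_simp
    by_contra! hcon
    nlinarith [mul_pos hη hcon]
  -- Young's inequality weighted to spend exactly half of the proximal decrease `ρ/(2η) N²`; the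
  -- other half is the `ρ/(4η)` in the conclusion.
  have h6 : e * N ≤ η / ρ * e ^ 2 + ρ / (4 * η) * N ^ 2 := by
    have : η / ρ * e ^ 2 + ρ / (4 * η) * N ^ 2 - e * N
        = (4 * η * ρ)⁻¹ * (2 * η * e - ρ * N) ^ 2 := by field_simp; ring
    have h7 : 0 ≤ (4 * η * ρ)⁻¹ * (2 * η * e - ρ * N) ^ 2 := by positivity
    linarith
  have h8 : ρ / (2 * η) * N ^ 2 = 2 * (ρ / (4 * η) * N ^ 2) := by field_simp; ring
  linarith

/-! ### Well-posedness and continuity of the proximal map -/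

lemma sq_l1Norm_midpoint_le (x y : Vec d) :
    l1Norm ((1 / 2 : ℝ) • x + (1 / 2 : ℝ) • y) ^ 2 ≤ 1 / 2 * l1Norm x ^ 2 + 1 / 2 * l1Norm y ^ 2 := by
  have h := l1Norm_add_le ((1 / 2 : ℝ) • x) ((1 / 2 : ℝ) • y)
  rw [l1Norm_smul, l1Norm_smul, abs_of_pos (by norm_num : (0 : ℝ) < 1 / 2)] at h
  have h2 := pow_le_pow_left₀ (l1Norm_nonneg _) h 2
  nlinarith [sq_nonneg (l1Norm x - l1Norm y)]

/-- Test minimality at the midpoint: the parallelogram law gains `‖y - x'‖²/8` there, which doubles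
to `1/4` after rearranging. -/
lemma IsProxPoint.strong_minimum (hX : Convex ℝ X) (hρ : 0 ≤ ρ) {x v x' : Vec d}
    (h : IsProxPoint X (proxTerm ρ) x v x') {y : Vec d} (hy : y ∈ X) :
    1 / 2 * ‖x' - v‖ ^ 2 + proxTerm ρ (x' - x) + 1 / 4 * ‖y - x'‖ ^ 2
      ≤ 1 / 2 * ‖y - v‖ ^ 2 + proxTerm ρ (y - x) := by
  have h1 := h.2 (hX h.1 hy (show (0 : ℝ) ≤ 1 / 2 by norm_num)
    (show (0 : ℝ) ≤ 1 / 2 by norm_num) (by norm_num))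
  simp only [Set.mem_ofPred_eq, proxTerm] at h1 ⊢
  have e1 : (1 / 2 : ℝ) • x' + (1 / 2 : ℝ) • y - v
      = (1 / 2 : ℝ) • ((x' - v) + (y - v)) := by module
  have e2 : (1 / 2 : ℝ) • x' + (1 / 2 : ℝ) • y - x
      = (1 / 2 : ℝ) • (x' - x) + (1 / 2 : ℝ) • (y - x) := by module
  have h2 := parallelogram_law_with_norm ℝ (y - v) (x' - v)
  have e3 : (y - v) - (x' - v) = y - x' := by abel
  rw [e3] at h2
  have h3 := mul_le_mul_of_nonneg_left (sq_l1Norm_midpoint_le (x' - x) (y - x))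
    (show 0 ≤ ρ / 2 by positivity)
  rw [e1, e2, norm_smul, add_comm (x' - v)] at h1
  norm_num at h1 h3 ⊢
  nlinarith

lemma IsProxPoint.unique (hX : Convex ℝ X) (hρ : 0 ≤ ρ) {x v x₁ x₂ : Vec d}
    (h₁ : IsProxPoint X (proxTerm ρ) x v x₁) (h₂ : IsProxPoint X (proxTerm ρ) x v x₂) :
    x₁ = x₂ := by
  have h3 := h₁.strong_minimum hX hρ h₂.1
  have h4 := h₂.2 h₁.1
  simp only [Set.mem_ofPred_eq] at h4
  have : ‖x₂ - x₁‖ ^ 2 ≤ 0 := by linarith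
  have h5 : ‖x₂ - x₁‖ = 0 := by nlinarith [norm_nonneg (x₂ - x₁)]
  exact (sub_eq_zero.1 (norm_eq_zero.1 h5)).symm

lemma exists_isProxPoint (hX : IsClosed X) (hne : X.Nonempty) (hρ : 0 ≤ ρ) (x v : Vec d) :
    ∃ x', IsProxPoint X (proxTerm ρ) x v x' := by
  obtain ⟨x₀, hx₀⟩ := hne
  set h : Vec d → ℝ := fun y => 1 / 2 * ‖y - v‖ ^ 2 + proxTerm ρ (y - x)
  have hc : Continuous h := by
    have := continuous_l1Norm (d := d)
    simp only [h, proxTerm]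
    fun_prop
  refine hc.continuousOn.exists_isMinOn' hX hx₀ ?_
  refine Filter.Eventually.filter_mono inf_le_left ?_
  -- Outside this ball `‖y - v‖²/2` already exceeds `h x₀`.
  filter_upwards [(isCompact_closedBall v (h x₀ + 2)).compl_mem_cocompact] with y hy
  rw [Set.mem_compl_iff, mem_closedBall_iff_norm, not_le] at hy
  have h0 : 0 ≤ h x₀ := by simp only [h, proxTerm]; positivity
  have h1 : 0 ≤ proxTerm ρ (y - x) := by simp only [proxTerm]; positivity
  have h2 : 1 / 2 * ‖y - v‖ ^ 2 ≤ h y := by simp only [h]; linarith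
  nlinarith

/-- Use each minimizer as competitor in the other's strong minimality and add: `δ² ≤ Aδ + B`, so `δ
≤ A + √B`. Only the distance `y₁ - x₁` at the first pair enters, so the bound tends to zero as the
second pair of data approaches the first. -/
lemma norm_sub_le_of_isProxPoint (hX : Convex ℝ X) (hρ : 0 ≤ ρ) {x₁ v₁ y₁ x₂ v₂ y₂ : Vec d}
    (h₁ : IsProxPoint X (proxTerm ρ) x₁ v₁ y₁) (h₂ : IsProxPoint X (proxTerm ρ) x₂ v₂ y₂) :
    ‖y₂ - y₁‖ ≤ 2 * (‖v₂ - v₁‖ + ρ * l1Norm (x₂ - x₁) * d)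
      + √(2 * ρ * l1Norm (x₂ - x₁) * (2 * l1Norm (y₁ - x₁) + l1Norm (x₂ - x₁))) := by
  have h3 := h₁.strong_minimum hX hρ h₂.1
  have h4 := h₂.strong_minimum hX hρ h₁.1
  rw [norm_sub_rev y₁ y₂] at h4
  have hinner : 1 / 2 * ‖y₂ - v₁‖ ^ 2 - 1 / 2 * ‖y₁ - v₁‖ ^ 2 + 1 / 2 * ‖y₁ - v₂‖ ^ 2
      - 1 / 2 * ‖y₂ - v₂‖ ^ 2 = inner ℝ (y₂ - y₁) (v₂ - v₁) := by
    simp only [norm_sub_sq_real, inner_sub_left, inner_sub_right]; ring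
  have hcs := real_inner_le_norm (y₂ - y₁) (v₂ - v₁)
  have a1 : l1Norm (y₂ - x₁) ≤ l1Norm (y₂ - y₁) + l1Norm (y₁ - x₁) := by
    simpa using l1Norm_add_le (y₂ - y₁) (y₁ - x₁)
  have a2 : l1Norm (y₂ - x₁) ≤ l1Norm (y₂ - x₂) + l1Norm (x₂ - x₁) := by
    simpa using l1Norm_add_le (y₂ - x₂) (x₂ - x₁)
  have a3 : l1Norm (y₂ - x₂) ≤ l1Norm (y₂ - x₁) + l1Norm (x₂ - x₁) := by
    rw [l1Norm_sub_comm x₂ x₁]; simpa using l1Norm_add_le (y₂ - x₁) (x₁ - x₂)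
  have a4 : l1Norm (y₁ - x₂) ≤ l1Norm (y₁ - x₁) + l1Norm (x₂ - x₁) := by
    rw [l1Norm_sub_comm x₂ x₁]; simpa using l1Norm_add_le (y₁ - x₁) (x₁ - x₂)
  have a5 := l1Norm_le_mul_norm (y₂ - y₁)
  have p1 := l1Norm_nonneg (x₂ - x₁)
  have p2 := l1Norm_nonneg (y₁ - x₁)
  have p3 := l1Norm_nonneg (y₂ - x₂)
  have p4 := l1Norm_nonneg (y₁ - x₂)
  have p5 := l1Norm_nonneg (y₂ - x₁)
  have p6 := l1Norm_nonneg (y₂ - y₁)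
  simp only [proxTerm] at h3 h4
  set n := l1Norm (x₂ - x₁)
  set a := l1Norm (y₁ - x₁)
  set δ := ‖y₂ - y₁‖
  have b1 : l1Norm (y₂ - x₁) ^ 2 - l1Norm (y₂ - x₂) ^ 2 ≤ n * (2 * (d * δ) + 2 * a + n) := by
    calc _ = (l1Norm (y₂ - x₁) - l1Norm (y₂ - x₂)) * (l1Norm (y₂ - x₁) + l1Norm (y₂ - x₂)) := by
          ring
      _ ≤ n * (l1Norm (y₂ - x₁) + l1Norm (y₂ - x₂)) :=
          mul_le_mul_of_nonneg_right (by linarith) (by linarith)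
      _ ≤ _ := mul_le_mul_of_nonneg_left (by linarith) p1
  have b2 : l1Norm (y₁ - x₂) ^ 2 - a ^ 2 ≤ n * (2 * a + n) := by
    have := pow_le_pow_left₀ p4 a4 2
    nlinarith
  have b3 := mul_le_mul_of_nonneg_left (add_le_add b1 b2) (show 0 ≤ ρ / 2 by positivity)
  have hδ : δ ^ 2 ≤ 2 * (‖v₂ - v₁‖ + ρ * n * d) * δ + 2 * ρ * n * (2 * a + n) := by
    nlinarith
  set A := 2 * (‖v₂ - v₁‖ + ρ * n * d)
  set B := 2 * ρ * n * (2 * a + n)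
  have hA : 0 ≤ A := by positivity
  have hB : 0 ≤ B := by positivity
  by_contra! hcon
  have hs := Real.sqrt_nonneg B
  have hs2 := Real.sq_sqrt hB
  nlinarith

/-- The solution map of the proximal step. -/
lemma exists_continuous_prox (hX : Convex ℝ X) (hcl : IsClosed X) (hne : X.Nonempty)
    (hρ : 0 ≤ ρ) : ∃ T : Vec d × Vec d → Vec d, Continuous T ∧
      ∀ x v x', IsProxPoint X (proxTerm ρ) x v x' → x' = T (x, v) := by
  choose T hT using fun p : Vec d × Vec d => exists_isProxPoint hcl hne hρ p.1 p.2
  refine ⟨T, continuous_iff_continuousAt.2 fun p => ?_, fun x v x' h => h.unique hX hρ (hT (x, v))⟩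
  rw [ContinuousAt, tendsto_iff_norm_sub_tendsto_zero]
  have hN := continuous_l1Norm (d := d)
  have hlim : Filter.Tendsto (fun p' : Vec d × Vec d =>
      2 * (‖p'.2 - p.2‖ + ρ * l1Norm (p'.1 - p.1) * d)
      + √(2 * ρ * l1Norm (p'.1 - p.1) * (2 * l1Norm (T p - p.1) + l1Norm (p'.1 - p.1))))
      (𝓝 p) (𝓝 0) := by
    have : Continuous (fun p' : Vec d × Vec d =>
      2 * (‖p'.2 - p.2‖ + ρ * l1Norm (p'.1 - p.1) * d)
      + √(2 * ρ * l1Norm (p'.1 - p.1) * (2 * l1Norm (T p - p.1) + l1Norm (p'.1 - p.1)))) := by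
      fun_prop
    simpa [l1Norm_zero] using this.tendsto p
  exact squeeze_zero (fun _ => norm_nonneg _)
    (fun p' => norm_sub_le_of_isProxPoint hX hρ (hT p) (hT p')) hlim

end Prox


/-! ### Second moments of averages of stochastic gradients -/

section Moments

variable {Ξ : Type*} [mΞ : MeasurableSpace Ξ] {P : Measure Ξ}

lemma convexOn_sq_linfNorm : ConvexOn ℝ Set.univ fun x : Vec d => linfNorm x ^ 2 := by
  refine ConvexOn.pow (f := linfNorm) ⟨convex_univ, fun x _ y _ a b ha hb _ => ?_⟩
    (fun x _ => linfNorm_nonneg x) 2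
  have := linfNorm_add_le (a • x) (b • y)
  rwa [linfNorm_smul, linfNorm_smul, abs_of_nonneg ha, abs_of_nonneg hb] at this

lemma sq_linfNorm_integral_le [IsProbabilityMeasure P] {h : Ξ → Vec d} (hint : Integrable h P)
    (hsq : Integrable (fun z => linfNorm (h z) ^ 2) P) :
    linfNorm (∫ z, h z ∂P) ^ 2 ≤ ∫ z, linfNorm (h z) ^ 2 ∂P :=
  convexOn_sq_linfNorm.map_integral_le (continuous_linfNorm.pow 2).continuousOn isClosed_univ
    (Filter.Eventually.of_forall fun _ => trivial) hint hsq

lemma sq_linfNorm_sub_le (x y : Vec d) :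
    linfNorm (x - y) ^ 2 ≤ 2 * linfNorm x ^ 2 + 2 * linfNorm y ^ 2 := by
  have := pow_le_pow_left₀ (linfNorm_nonneg _) (linfNorm_sub_le x y) 2
  nlinarith [sq_nonneg (linfNorm x - linfNorm y)]

/-- Source of the factor 4: outside a Hilbert norm, centring need not reduce the second moment, so
`‖h - E h‖² ≤ 2‖h‖² + 2‖E h‖²` is combined with Jensen. -/
lemma sq_linfNorm_sub_integral_le [IsProbabilityMeasure P] {h : Ξ → Vec d} {s : ℝ}
    (hint : Integrable h P) (hsq : Integrable (fun z => linfNorm (h z) ^ 2) P)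
    (hs : ∫ z, linfNorm (h z) ^ 2 ∂P ≤ s) :
    Integrable (fun z => linfNorm (h z - ∫ z', h z' ∂P) ^ 2) P ∧
      ∫ z, linfNorm (h z - ∫ z', h z' ∂P) ^ 2 ∂P ≤ 4 * s := by
  have hbound : Integrable (fun z => 2 * linfNorm (h z) ^ 2
      + 2 * linfNorm (∫ z', h z' ∂P) ^ 2) P := (hsq.const_mul 2).add (integrable_const _)
  have hi : Integrable (fun z => linfNorm (h z - ∫ z', h z' ∂P) ^ 2) P := by
    refine hbound.mono' (((continuous_linfNorm.pow 2)).comp_aestronglyMeasurable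
      (hint.1.sub aestronglyMeasurable_const)) (Filter.Eventually.of_forall fun z => ?_)
    rw [Real.norm_of_nonneg (sq_nonneg _)]
    exact sq_linfNorm_sub_le _ _
  refine ⟨hi, (integral_mono hi hbound fun z => sq_linfNorm_sub_le _ _).trans ?_⟩
  rw [integral_add (hsq.const_mul 2) (integrable_const _), integral_const_mul, integral_const,
    probReal_univ, one_smul]
  linarith [sq_linfNorm_integral_le hint hsq]

lemma lpSq_logExponent_le (hd : 2 ≤ d) (x : Vec d) :
    lpSq (logExponent d) x ≤ Real.exp 1 * linfNorm x ^ 2 := by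
  have hr : (1 : ℝ) ≤ logExponent d := by exact_mod_cast one_le_logExponent hd
  refine (lpSq_le_mul_sq_linfNorm hr x).trans ?_
  gcongr
  exact rpow_inv_logExponent_le hd

lemma integrable_lpSq (hd : 2 ≤ d) {h : Ξ → Vec d} (hm : AEStronglyMeasurable h P)
    (hsq : Integrable (fun z => linfNorm (h z) ^ 2) P) :
    Integrable (fun z => lpSq (logExponent d) (h z)) P := by
  have hr : (1 : ℝ) ≤ logExponent d := by exact_mod_cast one_le_logExponent hd
  refine (hsq.const_mul (Real.exp 1)).mono' ((continuous_lpSq hr).comp_aestronglyMeasurable hm)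
    (Filter.Eventually.of_forall fun z => ?_)
  rw [Real.norm_of_nonneg (lpSq_nonneg _)]
  exact lpSq_logExponent_le hd _

lemma lintegral_lpSq_le (hd : 2 ≤ d) {h : Ξ → Vec d} {s : ℝ}
    (hsq : Integrable (fun z => linfNorm (h z) ^ 2) P) (hs : ∫ z, linfNorm (h z) ^ 2 ∂P ≤ s) :
    ∫⁻ z, ENNReal.ofReal (lpSq (logExponent d) (h z)) ∂P ≤ ENNReal.ofReal (Real.exp 1 * s) := by
  calc _ ≤ ∫⁻ z, ENNReal.ofReal (Real.exp 1 * linfNorm (h z) ^ 2) ∂P :=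
        lintegral_mono fun z => ENNReal.ofReal_le_ofReal (lpSq_logExponent_le hd _)
    _ = ENNReal.ofReal (∫ z, Real.exp 1 * linfNorm (h z) ^ 2 ∂P) :=
        (ofReal_integral_eq_lintegral_ofReal (hsq.const_mul _)
          (Filter.Eventually.of_forall fun z => by positivity)).symm
    _ ≤ _ := by
        rw [integral_const_mul]
        gcongr

/-- The Nemirovski inequality in `ℓ_∞` for averages of conditionally independent vectors. -/
lemma lintegral_lpSq_average_le (hd : 2 ≤ d) {Ω β : Type*} [mΩ : MeasurableSpace Ω]
    [mβ : MeasurableSpace β] {μ : Measure Ω} [IsProbabilityMeasure μ] [IsProbabilityMeasure P]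
    {ℱ : ℕ → MeasurableSpace Ω} (hle : ∀ n, ℱ n ≤ mΩ) (hmono : Monotone ℱ)
    {ξ : ℕ → Ω → Ξ} (hξ : ∀ n, Measurable[ℱ (n + 1)] (ξ n)) (hlaw : ∀ n, μ.map (ξ n) = P)
    (hind : ∀ n, Indep (ℱ n) (mΞ.comap (ξ n)) μ)
    {w : Ω → β} (hw : Measurable[ℱ 0] w) {E : Ω → Vec d} (hE : Measurable[ℱ 0] E)
    {H : β → Ξ → Vec d} (hH : Measurable (Function.uncurry H)) {s : Ω → ℝ}
    (hint : ∀ ω, Integrable (H (w ω)) P)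
    (hsq : ∀ ω, Integrable (fun z => linfNorm (H (w ω) z) ^ 2) P)
    (hs : ∀ ω, ∫ z, linfNorm (H (w ω) z) ^ 2 ∂P ≤ s ω)
    (h0 : ∀ ω, ∫ z, H (w ω) z ∂P = 0) {m : ℕ} (hm : 1 ≤ m) :
    ∫⁻ ω, ENNReal.ofReal (lpSq (logExponent d)
        (E ω + (1 / (m : ℝ)) • ∑ i ∈ Finset.range m, H (w ω) (ξ i ω))) ∂μ ≤
      ∫⁻ ω, ENNReal.ofReal (lpSq (logExponent d) (E ω)) ∂μ +
        ENNReal.ofReal (dimFactor d ^ 2 / m) * ∫⁻ ω, ENNReal.ofReal (s ω) ∂μ := by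
  have hr := one_le_logExponent hd
  have hr' : (1 : ℝ) ≤ logExponent d := by exact_mod_cast hr
  have hm0 : (0 : ℝ) < m := by exact_mod_cast hm
  -- The weight `1/m` goes into the summands: the potential is 2-homogeneous, so `m` terms of size
  -- `1/m²` give the rate `1/m`.
  have key := lintegral_lpSq_sum_le (μ := μ) (P := P) hr hle hmono hξ hlaw hind hw hE
    (H := fun b z => (1 / (m : ℝ)) • H b z) (by
      have := hH.const_smul (1 / (m : ℝ))
      exact this)
    (fun ω => (hint ω).smul (1 / (m : ℝ)))
    (fun ω => by
      simp only [lpSq_smul hr']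
      exact (integrable_lpSq hd (hint ω).1 (hsq ω)).const_mul _)
    (fun ω => by rw [integral_smul, h0, smul_zero]) m
  simp only [← Finset.smul_sum] at key
  refine key.trans (add_le_add le_rfl ?_)
  have hC : (0 : ℝ) ≤ 2 * (4 * logExponent d - 3) := by linarith
  have hinner : ∀ ω, ∫⁻ z, ENNReal.ofReal (lpSq (logExponent d) ((1 / (m : ℝ)) • H (w ω) z)) ∂P
      ≤ ENNReal.ofReal ((1 / m) ^ 2 * Real.exp 1) * ENNReal.ofReal (s ω) := fun ω => by
    simp only [lpSq_smul hr']
    calc ∫⁻ z, ENNReal.ofReal ((1 / (m : ℝ)) ^ 2 * lpSq (logExponent d) (H (w ω) z)) ∂P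
        = ENNReal.ofReal ((1 / (m : ℝ)) ^ 2) *
            ∫⁻ z, ENNReal.ofReal (lpSq (logExponent d) (H (w ω) z)) ∂P := by
          rw [← lintegral_const_mul' _ _ ENNReal.ofReal_ne_top]
          simp only [ENNReal.ofReal_mul (sq_nonneg (1 / (m : ℝ)))]
      _ ≤ ENNReal.ofReal ((1 / (m : ℝ)) ^ 2) * ENNReal.ofReal (Real.exp 1 * s ω) := by
          gcongr; exact lintegral_lpSq_le hd (hsq ω) (hs ω)
      _ = _ := by
          rw [ENNReal.ofReal_mul (Real.exp_pos 1).le, ENNReal.ofReal_mul (sq_nonneg _), mul_assoc]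
  calc (m : ℝ≥0∞) * (ENNReal.ofReal (2 * (4 * logExponent d - 3)) *
        ∫⁻ ω, ∫⁻ z, ENNReal.ofReal (lpSq (logExponent d) ((1 / (m : ℝ)) • H (w ω) z)) ∂P ∂μ)
      ≤ (m : ℝ≥0∞) * (ENNReal.ofReal (2 * (4 * logExponent d - 3)) *
        ∫⁻ ω, ENNReal.ofReal ((1 / m) ^ 2 * Real.exp 1) * ENNReal.ofReal (s ω) ∂μ) := by
        gcongr with ω
        exact hinner ω
    _ = ENNReal.ofReal (m * (2 * (4 * logExponent d - 3) * ((1 / m) ^ 2 * Real.exp 1))) *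
        ∫⁻ ω, ENNReal.ofReal (s ω) ∂μ := by
        rw [lintegral_const_mul' _ _ ENNReal.ofReal_ne_top, ENNReal.ofReal_mul hm0.le,
          ENNReal.ofReal_mul hC, ENNReal.ofReal_natCast]
        simp only [mul_assoc]
    _ ≤ _ := by
        gcongr
        have : m * (2 * (4 * logExponent d - 3) * ((1 / (m : ℝ)) ^ 2 * Real.exp 1))
            = 2 * (4 * logExponent d - 3) * Real.exp 1 / m := by field_simp
        rw [this]
        gcongr
        exact smoothness_constant_le hd

end Moments

/-! ### Stochastic programs -/

section Program

variable {Ξ : Type*} {X : Set (Vec d)} {F : Vec d → Ξ → ℝ} {L : ℝ}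

/-- The stochastic gradient, extended by zero outside `X`. -/
noncomputable def gradOn (X : Set (Vec d)) (F : Vec d → Ξ → ℝ) (x : Vec d) (z : Ξ) : Vec d :=
  open Classical in if x ∈ X then stochGrad F x z else 0

lemma gradOn_of_mem {x : Vec d} (hx : x ∈ X) : gradOn X F x = stochGrad F x := by
  funext z; simp [gradOn, hx]

variable [mΞ : MeasurableSpace Ξ] {P : Measure Ξ}

/-- Measurability of the stochastic gradient is given only on `X × Ξ`; extension by zero off the
closed set `X` makes it composable with random points of the whole space. -/
lemma IsStochasticProgram.measurable_gradOn (h : IsStochasticProgram X F P) :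
    Measurable (Function.uncurry (gradOn X F)) := by
  have hS : MeasurableSet (X ×ˢ (Set.univ : Set Ξ)) :=
    h.isClosed.measurableSet.prod MeasurableSet.univ
  refine measurable_of_restrict_of_restrict_compl hS ?_ ?_
  · have e : (X ×ˢ (Set.univ : Set Ξ)).domRestrict (Function.uncurry (gradOn X F))
        = (fun p : X × Ξ => stochGrad F (p.1 : Vec d) p.2) ∘
          fun p : (X ×ˢ (Set.univ : Set Ξ) : Set _) => (⟨p.1.1, p.2.1⟩, p.1.2) := by
      funext p
      simp [Function.uncurry, gradOn, p.2.1]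
    rw [e]
    exact h.measurable_grad.comp (by fun_prop)
  · have e : (X ×ˢ (Set.univ : Set Ξ))ᶜ.domRestrict (Function.uncurry (gradOn X F))
        = fun _ => 0 := by
      funext p
      have : p.1.1 ∉ X := fun hp => p.2 ⟨hp, trivial⟩
      simp [Function.uncurry, gradOn, this]
    rw [e]
    exact measurable_const

/-- The mean stochastic gradient, a measurable function equal to `∇f` on `X`. -/
noncomputable def meanGrad (X : Set (Vec d)) (F : Vec d → Ξ → ℝ) (P : Measure Ξ) (x : Vec d) :
    Vec d := ∫ z, gradOn X F x z ∂P

lemma IsStochasticProgram.measurable_meanGrad [SFinite P] (h : IsStochasticProgram X F P) :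
    Measurable (meanGrad X F P) :=
  (h.measurable_gradOn.stronglyMeasurable.integral_prod_right (ν := P)).measurable

lemma IsStochasticProgram.meanGrad_eq (h : IsStochasticProgram X F P) {x : Vec d} (hx : x ∈ X) :
    meanGrad X F P x = gradient (objective F P) x := by
  rw [meanGrad, gradOn_of_mem hx, h.unbiased x hx]

/-- Jensen for `‖·‖_∞²` passes mean-square smoothness of the samples to their mean. -/
lemma IsStochasticProgram.lipschitzGradientOn [IsProbabilityMeasure P]
    (h : IsStochasticProgram X F P) (hL : 0 ≤ L) (hs : MeanSquaredSmooth X F P L) :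
    LipschitzGradientOn X (objective F P) L := by
  intro x hx y hy
  obtain ⟨h1, h2⟩ := hs x hx y hy
  have h3 := sq_linfNorm_integral_le ((h.integrable_grad x hx).sub (h.integrable_grad y hy)) h1
  rw [Pi.sub_def, integral_sub (h.integrable_grad x hx) (h.integrable_grad y hy),
    h.unbiased x hx, h.unbiased y hy] at h3
  have h4 := h3.trans h2
  rw [← mul_pow] at h4
  exact le_of_sq_le_sq h4 (mul_nonneg hL (l1Norm_nonneg _))

end Program


/-! ### Iterates of a run -/

lemma measurable_sum_gradOn {Ξ Ω : Type*} [MeasurableSpace Ξ] {mΩ : MeasurableSpace Ω}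
    {X : Set (Vec d)} {F : Vec d → Ξ → ℝ} {P : Measure Ξ} (hprog : IsStochasticProgram X F P)
    {n : ℕ} {u : Ω → Vec d} {z : ℕ → Ω → Ξ} (hu : Measurable u) (hz : ∀ i, Measurable (z i)) :
    Measurable fun ω => (1 / (n : ℝ)) • ∑ i ∈ Finset.range n, gradOn X F (u ω) (z i ω) := by
  have hsum : Measurable fun ω => ∑ i ∈ Finset.range n, gradOn X F (u ω) (z i ω) :=
    Finset.measurable_sum _ fun i _ => hprog.measurable_gradOn.comp (hu.prodMk (hz i))
  exact hsum.const_smul (1 / (n : ℝ))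

lemma measurable_sum_gradOn_sub {Ξ Ω : Type*} [MeasurableSpace Ξ] {mΩ : MeasurableSpace Ω}
    {X : Set (Vec d)} {F : Vec d → Ξ → ℝ} {P : Measure Ξ} (hprog : IsStochasticProgram X F P)
    {n : ℕ} {u v g : Ω → Vec d} {z : ℕ → Ω → Ξ} (hu : Measurable u) (hv : Measurable v)
    (hz : ∀ i, Measurable (z i)) (hg : Measurable g) :
    Measurable fun ω => (1 / (n : ℝ)) • ∑ i ∈ Finset.range n,
      (gradOn X F (u ω) (z i ω) - gradOn X F (v ω) (z i ω)) + g ω := by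
  have hsum : Measurable fun ω => ∑ i ∈ Finset.range n,
      (gradOn X F (u ω) (z i ω) - gradOn X F (v ω) (z i ω)) :=
    Finset.measurable_sum _ fun i _ => Measurable.sub
      (hprog.measurable_gradOn.comp (hu.prodMk (hz i)))
      (hprog.measurable_gradOn.comp (hv.prodMk (hz i)))
  have hsmul : Measurable fun ω => (1 / (n : ℝ)) • ∑ i ∈ Finset.range n,
      (gradOn X F (u ω) (z i ω) - gradOn X F (v ω) (z i ω)) := hsum.const_smul (1 / (n : ℝ))
  exact hsmul.add hg

lemma measurable_residual_comp {Ω : Type*} {mΩ : MeasurableSpace Ω} {X : Set (Vec d)}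
    {f : Vec d → ℝ} {L : ℝ} (hL : 0 ≤ L) (hX : Convex ℝ X) (hf : Differentiable ℝ f)
    (h : LipschitzGradientOn X f L) {u : Ω → Vec d} (hu : Measurable u) (hmem : ∀ ω, u ω ∈ X) :
    Measurable fun ω => residual f X (u ω) := by
  have hu' : Measurable fun ω => (⟨u ω, hmem ω⟩ : X) := hu.subtype_mk
  have hcomp := (measurable_residual hL hX hf h).comp hu'
  simpa only [Function.comp_def] using hcomp

/-- The indices of the samples drawn before sample `n` of iteration `k`. -/
def samplesBefore (k n : ℕ) : Set (ℕ × ℕ) := {p | p.1 < k ∨ p.1 = k ∧ p.2 < n}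

lemma measurable_sample_samplesBefore {Ξ Ω : Type*} [MeasurableSpace Ξ]
    {x : ℕ → Ω → Vec d} {ζ : ℕ → ℕ → Ω → Ξ} (k i : ℕ) :
    Measurable[history (x 1) ζ (samplesBefore (k + 1) 0)] (ζ k i) :=
  measurable_history_sample (Or.inl (Nat.lt_succ_self k))

section Run

variable {Ξ : Type*} [mΞ : MeasurableSpace Ξ] {Ω : Type*} {mΩ : MeasurableSpace Ω}
  {X : Set (Vec d)} {F : Vec d → Ξ → ℝ} {P : Measure Ξ} {φ : Vec d → ℝ} {η ρ L σ : ℝ}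
  {K q m m₁ : ℕ} {μ : Measure Ω} {ζ : ℕ → ℕ → Ω → Ξ} {x G : ℕ → Ω → Vec d} {Y : Ω → ℕ}

lemma samplesBefore_mono (k : ℕ) : Monotone (samplesBefore k) := by
  rintro a b hab ⟨i, j⟩ (h | ⟨h, h'⟩)
  · exact Or.inl h
  · exact Or.inr ⟨h, h'.trans_le hab⟩

lemma samplesBefore_zero_subset {k l : ℕ} (h : k ≤ l) : samplesBefore k 0 ⊆ samplesBefore l 0 := by
  rintro ⟨i, j⟩ (h1 | ⟨_, h1⟩)
  · exact Or.inl (lt_of_lt_of_le h1 h)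
  · exact absurd h1 (Nat.not_lt_zero _)

lemma IsRun.mem (h : IsRun X F P φ η K q m m₁ μ ζ x G Y) {k : ℕ} (h1 : 1 ≤ k) (hK : k ≤ K + 1)
    (ω : Ω) : x k ω ∈ X := by
  obtain ⟨k, rfl⟩ := Nat.exists_eq_add_of_le' h1
  rcases k.eq_zero_or_pos with rfl | hk
  · exact h.init_mem ω
  · exact (h.step k (Finset.mem_Icc.2 ⟨hk, by omega⟩) ω).1

lemma IsRun.estimate_restart (h : IsRun X F P φ η K q m m₁ μ ζ x G Y) {k : ℕ} (h1 : 1 ≤ k)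
    (hK : k ≤ K) (hk : k ≡ 1 [MOD q]) (ω : Ω) :
    G k ω = (1 / (m₁ : ℝ)) • ∑ i ∈ Finset.range m₁, gradOn X F (x k ω) (ζ k i ω) := by
  rw [h.estimate k (Finset.mem_Icc.2 ⟨h1, hK⟩) ω, spiderEstimate, if_pos hk, batchSize, if_pos hk,
    gradOn_of_mem (h.mem h1 (by omega) ω)]

/-- Iteration 1 is a restart for every `q`, so the unconstrained values `x 0` and `G 0` never enter.
-/
lemma one_lt_of_not_modEq {k : ℕ} (h1 : 1 ≤ k) (hk : ¬ k ≡ 1 [MOD q]) : 2 ≤ k := by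
  rcases h1.eq_or_lt with rfl | h
  · exact absurd rfl hk
  · exact h

lemma IsRun.estimate_update (h : IsRun X F P φ η K q m m₁ μ ζ x G Y) {k : ℕ} (h1 : 1 ≤ k)
    (hK : k ≤ K) (hk : ¬ k ≡ 1 [MOD q]) (ω : Ω) :
    G k ω = (1 / (m : ℝ)) • ∑ i ∈ Finset.range m,
      (gradOn X F (x k ω) (ζ k i ω) - gradOn X F (x (k - 1) ω) (ζ k i ω)) + G (k - 1) ω := by
  have h2 := one_lt_of_not_modEq h1 hk
  rw [h.estimate k (Finset.mem_Icc.2 ⟨h1, hK⟩) ω, spiderEstimate, if_neg hk, batchSize, if_neg hk,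
    gradOn_of_mem (h.mem h1 (by omega) ω), gradOn_of_mem (h.mem (by omega) (by omega) ω),
    Finset.sum_sub_distrib]

lemma IsRun.measurable_estimate (h : IsRun X F P φ η K q m m₁ μ ζ x G Y)
    (hprog : IsStochasticProgram X F P) {k : ℕ} (h1 : 1 ≤ k) (hK : k ≤ K)
    {mΩ' : MeasurableSpace Ω} (hx : Measurable[mΩ'] (x k))
    (hprev : ¬ k ≡ 1 [MOD q] → Measurable[mΩ'] (x (k - 1)) ∧ Measurable[mΩ'] (G (k - 1)))
    (hζ : ∀ i, Measurable[mΩ'] (ζ k i)) : Measurable[mΩ'] (G k) := by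
  by_cases hk : k ≡ 1 [MOD q]
  · rw [show G k = _ from funext fun ω => h.estimate_restart h1 hK hk ω]
    exact measurable_sum_gradOn hprog hx hζ
  · obtain ⟨hx', hG'⟩ := hprev hk
    rw [show G k = _ from funext fun ω => h.estimate_update h1 hK hk ω]
    exact measurable_sum_gradOn_sub hprog hx hx' hζ hG'

/-- `x k` depends on samples of iterations before `k`, while `G k` also uses iteration `k`; hence
the shifted histories and the joint induction. Continuity of the proximal map carries measurability
to the next iterate. -/
lemma IsRun.measurable_iterate_estimate (h : IsRun X F P (proxTerm ρ) η K q m m₁ μ ζ x G Y)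
    (hprog : IsStochasticProgram X F P) (hne : X.Nonempty) (hρ : 0 ≤ ρ) {k : ℕ} (h1 : 1 ≤ k) :
    (k ≤ K + 1 → Measurable[history (x 1) ζ (samplesBefore k 0)] (x k)) ∧
      (k ≤ K → Measurable[history (x 1) ζ (samplesBefore (k + 1) 0)] (G k)) := by
  have hmono : ∀ k, history (x 1) ζ (samplesBefore k 0) ≤
      history (x 1) ζ (samplesBefore (k + 1) 0) :=
    fun k => history_mono (samplesBefore_zero_subset k.le_succ)
  obtain ⟨T, hT, hstep⟩ := exists_continuous_prox hprog.convex hprog.isClosed hne hρ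
  induction k, h1 using Nat.le_induction with
  | base =>
    refine ⟨fun _ => measurable_history_init _, fun hK => ?_⟩
    exact h.measurable_estimate hprog le_rfl hK (measurable_history_init _)
      (fun hk => absurd rfl hk) (measurable_sample_samplesBefore 1)
  | succ k hk ih =>
    obtain ⟨ihx, ihG⟩ := ih
    have hx : k + 1 ≤ K + 1 → Measurable[history (x 1) ζ (samplesBefore (k + 1) 0)] (x (k + 1)) := by
      intro hK
      have hxk := (ihx (by omega)).mono (hmono k) le_rfl
      have e : x (k + 1) = fun ω => T (x k ω, x k ω - η • G k ω) := funext fun ω =>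
        hstep _ _ _ (h.step k (Finset.mem_Icc.2 ⟨hk, by omega⟩) ω)
      rw [e]
      exact hT.measurable.comp (hxk.prodMk (hxk.sub ((ihG (by omega)).const_smul η)))
    refine ⟨hx, fun hK => ?_⟩
    refine h.measurable_estimate hprog (by omega) hK ((hx (by omega)).mono (hmono _) le_rfl)
      (fun _ => ⟨?_, ?_⟩) (measurable_sample_samplesBefore (k + 1))
    · exact ((ihx (by omega)).mono (hmono k) le_rfl).mono (hmono _) le_rfl
    · exact (ihG (by omega)).mono (hmono _) le_rfl

/-- The error of the gradient estimate. -/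
noncomputable def gradError (F : Vec d → Ξ → ℝ) (P : Measure Ξ) (x G : ℕ → Ω → Vec d) (k : ℕ)
    (ω : Ω) : Vec d := G k ω - gradient (objective F P) (x k ω)

lemma smul_sum_sub_const {V : Type*} [AddCommGroup V] [Module ℝ V] {n : ℕ} (hn : 1 ≤ n) (u : ℕ → V)
    (v : V) : (1 / (n : ℝ)) • ∑ i ∈ Finset.range n, (u i - v)
      = (1 / (n : ℝ)) • ∑ i ∈ Finset.range n, u i - v := by
  have : (n : ℝ) ≠ 0 := by positivity
  rw [Finset.sum_sub_distrib, Finset.sum_const, Finset.card_range, smul_sub,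
    ← Nat.cast_smul_eq_nsmul ℝ, smul_smul, one_div_mul_cancel this, one_smul]

/-! ### Error, descent and residual estimates along a run -/

section Bounds

variable [IsProbabilityMeasure P]

lemma IsRun.gradError_measurable (h : IsRun X F P (proxTerm ρ) η K q m m₁ μ ζ x G Y)
    (hprog : IsStochasticProgram X F P) (hne : X.Nonempty) (hρ : 0 ≤ ρ) {k : ℕ} (h1 : 1 ≤ k)
    (hK : k ≤ K) :
    Measurable[history (x 1) ζ (samplesBefore (k + 1) 0)] (gradError F P x G k) := by
  obtain ⟨hx, hG⟩ := h.measurable_iterate_estimate hprog hne hρ h1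
  have e : gradError F P x G k = fun ω => G k ω - meanGrad X F P (x k ω) := funext fun ω => by
    rw [gradError, hprog.meanGrad_eq (h.mem h1 (by omega) ω)]
  rw [e]
  exact (hG hK).sub (hprog.measurable_meanGrad.comp ((hx (by omega)).mono
    (history_mono (samplesBefore_zero_subset k.le_succ)) le_rfl))

/-- The filtration runs inside iteration `k`, revealing its samples one at a time; its initial
σ-algebra carries everything from earlier iterations. -/
lemma IsRun.average_bound [IsProbabilityMeasure μ]
    (h : IsRun X F P (proxTerm ρ) η K q m m₁ μ ζ x G Y) (hd : 2 ≤ d) (k : ℕ)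
    {β : Type*} [mβ : MeasurableSpace β] {w : Ω → β}
    (hw : Measurable[history (x 1) ζ (samplesBefore k 0)] w) {E : Ω → Vec d}
    (hE : Measurable[history (x 1) ζ (samplesBefore k 0)] E)
    {H : β → Ξ → Vec d} (hH : Measurable (Function.uncurry H)) {s : Ω → ℝ}
    (hint : ∀ ω, Integrable (H (w ω)) P)
    (hsq : ∀ ω, Integrable (fun z => linfNorm (H (w ω) z) ^ 2) P)
    (hs : ∀ ω, ∫ z, linfNorm (H (w ω) z) ^ 2 ∂P ≤ s ω)
    (h0 : ∀ ω, ∫ z, H (w ω) z ∂P = 0) {n : ℕ} (hn : 1 ≤ n) :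
    ∫⁻ ω, ENNReal.ofReal (lpSq (logExponent d)
        (E ω + (1 / (n : ℝ)) • ∑ i ∈ Finset.range n, H (w ω) (ζ k i ω))) ∂μ ≤
      ∫⁻ ω, ENNReal.ofReal (lpSq (logExponent d) (E ω)) ∂μ +
        ENNReal.ofReal (dimFactor d ^ 2 / n) * ∫⁻ ω, ENNReal.ofReal (s ω) ∂μ :=
  lintegral_lpSq_average_le hd (ℱ := fun n => history (x 1) ζ (samplesBefore k n))
    (fun n => history_le h.init_measurable h.sample_measurable _)
    (fun _ _ hab => history_mono (samplesBefore_mono k hab))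
    (fun n => measurable_history_sample (Or.inr ⟨rfl, n.lt_succ_self⟩))
    (fun n => h.sample_law k n)
    (fun n => indep_history_sample h.init_measurable h.sample_measurable h.sample_indep
      h.init_indep (by simp [samplesBefore]))
    hw hE hH hint hsq hs h0 hn

lemma IsRun.lintegral_gradError_restart [IsProbabilityMeasure μ]
    (h : IsRun X F P (proxTerm ρ) η K q m m₁ μ ζ x G Y)
    (hd : 2 ≤ d) (hprog : IsStochasticProgram X F P) (hne : X.Nonempty) (hρ : 0 ≤ ρ)
    (hσ : BoundedVariance X F P σ) (hm₁ : 1 ≤ m₁) {k : ℕ} (h1 : 1 ≤ k) (hK : k ≤ K)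
    (hk : k ≡ 1 [MOD q]) :
    ∫⁻ ω, ENNReal.ofReal (lpSq (logExponent d) (gradError F P x G k ω)) ∂μ ≤
      ENNReal.ofReal (dimFactor d ^ 2 * σ ^ 2 / m₁) := by
  have hr : (1 : ℝ) ≤ logExponent d := by exact_mod_cast one_le_logExponent hd
  have hmem := fun ω => h.mem h1 (by omega : k ≤ K + 1) ω
  have hx := (h.measurable_iterate_estimate hprog hne hρ h1).1 (by omega)
  have hHm : ∀ ω z, gradOn X F (x k ω) z - meanGrad X F P (x k ω)
      = stochGrad F (x k ω) z - gradient (objective F P) (x k ω) := fun ω z => by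
    rw [gradOn_of_mem (hmem ω), hprog.meanGrad_eq (hmem ω)]
  have key := h.average_bound hd k (w := x k) hx (E := fun _ => 0) measurable_const
    (H := fun y z => gradOn X F y z - meanGrad X F P y)
    (hprog.measurable_gradOn.sub (hprog.measurable_meanGrad.comp measurable_fst))
    (s := fun _ => σ ^ 2)
    (fun ω => by
      simp only [hHm]; exact (hprog.integrable_grad _ (hmem ω)).sub (integrable_const _))
    (fun ω => by simp only [hHm]; exact (hσ _ (hmem ω)).1)
    (fun ω => by simp only [hHm]; exact (hσ _ (hmem ω)).2)
    (fun ω => by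
      simp only [hHm]
      rw [integral_sub (hprog.integrable_grad _ (hmem ω)) (integrable_const _),
        hprog.unbiased _ (hmem ω), integral_const, probReal_univ, one_smul, sub_self]) hm₁
  simp only [lpSq_zero hr, ENNReal.ofReal_zero, lintegral_zero, zero_add, lintegral_const,
    measure_univ, mul_one] at key
  rw [← ENNReal.ofReal_mul (by positivity), div_mul_eq_mul_div] at key
  refine le_trans (le_of_eq (lintegral_congr fun ω => ?_)) key
  rw [smul_sum_sub_const hm₁, gradError, h.estimate_restart h1 hK hk, hprog.meanGrad_eq (hmem ω)]

/-- The new error is the old one plus an average of centred gradient increments. The old error,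
known before these samples are drawn, takes the role of `E` in the averaging bound. -/
lemma IsRun.lintegral_gradError_update [IsProbabilityMeasure μ]
    (h : IsRun X F P (proxTerm ρ) η K q m m₁ μ ζ x G Y)
    (hd : 2 ≤ d) (hprog : IsStochasticProgram X F P) (hne : X.Nonempty) (hρ : 0 ≤ ρ)
    (hsmooth : MeanSquaredSmooth X F P L) (hm : 1 ≤ m) {k : ℕ} (h1 : 1 ≤ k) (hK : k + 1 ≤ K)
    (hk : ¬ k + 1 ≡ 1 [MOD q]) :
    ∫⁻ ω, ENNReal.ofReal (lpSq (logExponent d) (gradError F P x G (k + 1) ω)) ∂μ ≤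
      ∫⁻ ω, ENNReal.ofReal (lpSq (logExponent d) (gradError F P x G k ω)) ∂μ +
        ENNReal.ofReal (4 * dimFactor d ^ 2 * L ^ 2 / m) *
          ∫⁻ ω, ENNReal.ofReal (l1Norm (x (k + 1) ω - x k ω) ^ 2) ∂μ := by
  have hmem := fun ω => h.mem h1 (by omega : k ≤ K + 1) ω
  have hmem' := fun ω => h.mem (by omega : 1 ≤ k + 1) (by omega) ω
  have hx' := (h.measurable_iterate_estimate hprog hne hρ (by omega : 1 ≤ k + 1)).1 (by omega)
  have hx := ((h.measurable_iterate_estimate hprog hne hρ h1).1 (by omega)).mono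
    (history_mono (samplesBefore_zero_subset k.le_succ)) le_rfl
  have hD : ∀ ω, Integrable
      (fun z => stochGrad F (x (k + 1) ω) z - stochGrad F (x k ω) z) P := fun ω =>
    (hprog.integrable_grad _ (hmem' ω)).sub (hprog.integrable_grad _ (hmem ω))
  have hDint : ∀ ω, ∫ z, (stochGrad F (x (k + 1) ω) z - stochGrad F (x k ω) z) ∂P
      = gradient (objective F P) (x (k + 1) ω) - gradient (objective F P) (x k ω) := fun ω => by
    rw [integral_sub (hprog.integrable_grad _ (hmem' ω)) (hprog.integrable_grad _ (hmem ω)),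
      hprog.unbiased _ (hmem ω), hprog.unbiased _ (hmem' ω)]
  have hHm : ∀ ω z, (gradOn X F (x (k + 1) ω) z - gradOn X F (x k ω) z)
      - (meanGrad X F P (x (k + 1) ω) - meanGrad X F P (x k ω))
      = (stochGrad F (x (k + 1) ω) z - stochGrad F (x k ω) z)
        - ∫ z', (stochGrad F (x (k + 1) ω) z' - stochGrad F (x k ω) z') ∂P := fun ω z => by
    rw [gradOn_of_mem (hmem ω), hprog.meanGrad_eq (hmem ω), gradOn_of_mem (hmem' ω),
      hprog.meanGrad_eq (hmem' ω), hDint]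
  have hsq := fun ω => sq_linfNorm_sub_integral_le (hD ω)
    (hsmooth _ (hmem' ω) _ (hmem ω)).1 (hsmooth _ (hmem' ω) _ (hmem ω)).2
  have hg := hprog.measurable_gradOn
  have hg' := hprog.measurable_meanGrad
  have key := h.average_bound hd (k + 1) (w := fun ω => (x (k + 1) ω, x k ω)) (hx'.prodMk hx)
    (E := gradError F P x G k) (h.gradError_measurable hprog hne hρ h1 (by omega))
    (H := fun y z => (gradOn X F y.1 z - gradOn X F y.2 z)
      - (meanGrad X F P y.1 - meanGrad X F P y.2))
    (by
      refine Measurable.sub (Measurable.sub ?_ ?_) (Measurable.sub ?_ ?_)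
      · exact hg.comp ((measurable_fst.comp measurable_fst).prodMk measurable_snd)
      · exact hg.comp ((measurable_snd.comp measurable_fst).prodMk measurable_snd)
      · exact hg'.comp (measurable_fst.comp measurable_fst)
      · exact hg'.comp (measurable_snd.comp measurable_fst))
    (s := fun ω => 4 * (L ^ 2 * l1Norm (x (k + 1) ω - x k ω) ^ 2))
    (fun ω => by
      simp only [hHm]; exact (hD ω).sub (integrable_const _))
    (fun ω => by simp only [hHm]; exact (hsq ω).1)
    (fun ω => by simp only [hHm]; exact (hsq ω).2)
    (fun ω => by
      simp only [hHm]
      rw [integral_sub (hD ω) (integrable_const _), integral_const, probReal_univ, one_smul,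
        sub_self]) hm
  have e : ENNReal.ofReal (dimFactor d ^ 2 / m) *
        ∫⁻ ω, ENNReal.ofReal (4 * (L ^ 2 * l1Norm (x (k + 1) ω - x k ω) ^ 2)) ∂μ
      = ENNReal.ofReal (4 * dimFactor d ^ 2 * L ^ 2 / m) *
          ∫⁻ ω, ENNReal.ofReal (l1Norm (x (k + 1) ω - x k ω) ^ 2) ∂μ := by
    rw [← lintegral_const_mul' _ _ ENNReal.ofReal_ne_top,
      ← lintegral_const_mul' _ _ ENNReal.ofReal_ne_top]
    refine lintegral_congr fun ω => ?_
    rw [← ENNReal.ofReal_mul (by positivity), ← ENNReal.ofReal_mul (by positivity)]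
    congr 1; ring
  rw [e] at key
  refine le_trans (le_of_eq (lintegral_congr fun ω => ?_)) key
  rw [smul_sum_sub_const hm, hprog.meanGrad_eq (hmem ω), hprog.meanGrad_eq (hmem' ω), gradError,
    gradError, h.estimate_update (by omega) hK hk, Nat.add_sub_cancel]
  congr 2
  abel

/-- Subtracting the lower bound makes the objective nonnegative, so the pointwise descent can be
integrated without knowing that `f(x^k)` is integrable. -/
lemma IsRun.lintegral_descent [IsProbabilityMeasure μ]
    (h : IsRun X F P (proxTerm ρ) η K q m m₁ μ ζ x G Y)
    (hd : 2 ≤ d) (hprog : IsStochasticProgram X F P) (hne : X.Nonempty) (hρ : 0 < ρ) (hη : 0 < η)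
    (hL : 0 ≤ L) (hsmooth : MeanSquaredSmooth X F P L) (hpos : 0 ≤ ρ / (4 * η) - L / 2) {fLow : ℝ}
    (hfLow : ∀ x ∈ X, fLow ≤ objective F P x) {k : ℕ} (h1 : 1 ≤ k) (hK : k ≤ K) :
    ENNReal.ofReal (ρ / (4 * η) - L / 2) *
        ∫⁻ ω, ENNReal.ofReal (l1Norm (x (k + 1) ω - x k ω) ^ 2) ∂μ +
      ∫⁻ ω, ENNReal.ofReal (objective F P (x (k + 1) ω) - fLow) ∂μ ≤
    ∫⁻ ω, ENNReal.ofReal (objective F P (x k ω) - fLow) ∂μ + ENNReal.ofReal (η / ρ) *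
      ∫⁻ ω, ENNReal.ofReal (lpSq (logExponent d) (gradError F P x G k ω)) ∂μ := by
  have hr : (1 : ℝ) ≤ logExponent d := by exact_mod_cast one_le_logExponent hd
  have hle := fun S => history_le h.init_measurable h.sample_measurable S
  have hx := ((h.measurable_iterate_estimate hprog hne hρ.le h1).1 (by omega)).mono (hle _) le_rfl
  have hx' := ((h.measurable_iterate_estimate hprog hne hρ.le (by omega : 1 ≤ k + 1)).1
    (by omega)).mono (hle _) le_rfl
  have hf := hprog.differentiable.continuous.measurable
  have hΦ : Measurable fun ω => ENNReal.ofReal (objective F P (x k ω) - fLow) :=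
    ((hf.comp hx).sub_const fLow).ennreal_ofReal
  have hΦ' : Measurable fun ω => ENNReal.ofReal (objective F P (x (k + 1) ω) - fLow) :=
    ((hf.comp hx').sub_const fLow).ennreal_ofReal
  rw [← lintegral_const_mul' _ _ ENNReal.ofReal_ne_top,
    ← lintegral_const_mul' _ _ ENNReal.ofReal_ne_top,
    ← lintegral_add_right _ hΦ',
    ← lintegral_add_left hΦ]
  refine lintegral_mono fun ω => ?_
  have hdesc := descent_of_isProxPoint hprog.convex hprog.differentiable
    (hprog.lipschitzGradientOn hL hsmooth) hρ hη (h.mem h1 (by omega) ω)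
    (h.step k (Finset.mem_Icc.2 ⟨h1, hK⟩) ω)
  have hV := sq_linfNorm_le_lpSq hr (gradError F P x G k ω)
  have hV' := mul_le_mul_of_nonneg_left hV (show 0 ≤ η / ρ by positivity)
  have p1 := hfLow _ (h.mem h1 (by omega) ω)
  have p2 := hfLow _ (h.mem (by omega : 1 ≤ k + 1) (by omega) ω)
  have p3 := lpSq_nonneg (p := logExponent d) (gradError F P x G k ω)
  rw [← ENNReal.ofReal_mul hpos, ← ENNReal.ofReal_mul (by positivity),
    ← ENNReal.ofReal_add (by positivity) (by linarith),
    ← ENNReal.ofReal_add (by linarith) (by positivity)]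
  apply ENNReal.ofReal_le_ofReal
  rw [gradError] at hV'
  rw [gradError]
  linarith

lemma IsRun.residual_le (h : IsRun X F P (proxTerm ρ) η K q m m₁ μ ζ x G Y)
    (hprog : IsStochasticProgram X F P) (hρ : 0 ≤ ρ) (hη : 0 < η) (hL : 0 ≤ L)
    (hsmooth : MeanSquaredSmooth X F P L) {k : ℕ} (h1 : 1 ≤ k) (hK : k ≤ K) (ω : Ω) :
    residual (objective F P) X (x (k + 1) ω) ≤
      ENNReal.ofReal (L + (ρ + 1) / η) * ENNReal.ofReal (l1Norm (x (k + 1) ω - x k ω)) +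
        ENNReal.ofReal (linfNorm (gradError F P x G k ω)) := by
  refine (residual_le_of_isProxPoint hprog.convex hprog.differentiable
    (hprog.lipschitzGradientOn hL hsmooth) hρ hη (h.mem h1 (by omega) ω)
    (h.step k (Finset.mem_Icc.2 ⟨h1, hK⟩) ω)).trans ?_
  rw [← ENNReal.ofReal_mul (by positivity), ← ENNReal.ofReal_add
    (mul_nonneg (by positivity) (l1Norm_nonneg _)) (linfNorm_nonneg _), gradError]

lemma IsRun.measurable_residual (h : IsRun X F P (proxTerm ρ) η K q m m₁ μ ζ x G Y)
    (hprog : IsStochasticProgram X F P) (hne : X.Nonempty) (hρ : 0 ≤ ρ) (hL : 0 ≤ L)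
    (hsmooth : MeanSquaredSmooth X F P L) {k : ℕ} (h1 : 1 ≤ k) (hK : k ≤ K + 1) :
    Measurable[history (x 1) ζ (samplesBefore k 0)]
      fun ω => residual (objective F P) X (x k ω) := by
  have hx := (h.measurable_iterate_estimate hprog hne hρ h1).1 hK
  exact measurable_residual_comp hL hprog.convex hprog.differentiable
    (hprog.lipschitzGradientOn hL hsmooth) hx fun ω => h.mem h1 hK ω

end Bounds

end Run


/-! ### The recursion over epochs -/

section Recursion

variable {D E Φ : ℕ → ℝ≥0∞} {K q : ℕ}

/-- Unroll back to the last restart. Indices are zero-based here, so restarts are the multiples of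
`q` and `n - n % q` is the latest one. -/
lemma epoch_error_le {A B : ℝ≥0∞} (h1 : ∀ n < K, n % q = 0 → E n ≤ A)
    (h2 : ∀ n, n + 1 < K → (n + 1) % q ≠ 0 → E (n + 1) ≤ E n + B * D n) {n : ℕ} (hn : n < K) :
    E n ≤ A + B * ∑ j ∈ Finset.Ico (n - n % q) n, D j := by
  induction n with
  | zero => simpa using h1 0 hn (Nat.zero_mod q)
  | succ n ih =>
    by_cases hmod : (n + 1) % q = 0
    · exact (h1 _ hn hmod).trans le_self_add
    · have e : (n + 1) % q = n % q + 1 := by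
        rcases q.eq_zero_or_pos with rfl | hq
        · simp
        have hlt : n % q + 1 < q := by
          refine lt_of_le_of_ne (Nat.mod_lt n hq) fun h => hmod ?_
          rw [← Nat.mod_add_mod, h, Nat.mod_self]
        rw [← Nat.mod_add_mod, Nat.mod_eq_of_lt hlt]
      rw [e, Nat.add_sub_add_right, Finset.sum_Ico_succ_top (Nat.sub_le _ _), mul_add, ← add_assoc]
      exact (h2 n hn hmod).trans (add_le_add (ih (by omega)) le_rfl)

/-- Exchange the sums: `D j` occurs only for `n` in a window of length `q` starting at `j`. -/
lemma sum_epoch_le (hq : 1 ≤ q) :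
    ∑ n ∈ Finset.range K, ∑ j ∈ Finset.Ico (n - n % q) n, D j
      ≤ q * ∑ j ∈ Finset.range K, D j := by
  calc ∑ n ∈ Finset.range K, ∑ j ∈ Finset.Ico (n - n % q) n, D j
      ≤ ∑ n ∈ Finset.range K, ∑ j ∈ Finset.range K with n ∈ Finset.Ico j (j + q), D j := by
        refine Finset.sum_le_sum fun n hn => Finset.sum_le_sum_of_subset fun j hj => ?_
        have := Nat.mod_lt n hq
        simp only [Finset.mem_filter, Finset.mem_range, Finset.mem_Ico] at hn hj ⊢
        omega
    _ = ∑ j ∈ Finset.range K, ∑ n ∈ Finset.range K with n ∈ Finset.Ico j (j + q), D j := by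
        simp only [Finset.sum_filter]
        exact Finset.sum_comm
    _ ≤ ∑ j ∈ Finset.range K, q * D j := by
        refine Finset.sum_le_sum fun j _ => ?_
        rw [Finset.sum_const, nsmul_eq_mul]
        gcongr
        calc _ ≤ (Finset.Ico j (j + q)).card :=
              Finset.card_le_card fun n hn => (Finset.mem_filter.1 hn).2
          _ = q := by simp
    _ = _ := by rw [Finset.mul_sum]

lemma sum_error_le {A B : ℝ≥0∞} (hq : 1 ≤ q) (h1 : ∀ n < K, n % q = 0 → E n ≤ A)
    (h2 : ∀ n, n + 1 < K → (n + 1) % q ≠ 0 → E (n + 1) ≤ E n + B * D n) :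
    ∑ n ∈ Finset.range K, E n ≤ K * A + B * (q * ∑ n ∈ Finset.range K, D n) := by
  calc _ ≤ ∑ n ∈ Finset.range K, (A + B * ∑ j ∈ Finset.Ico (n - n % q) n, D j) :=
        Finset.sum_le_sum fun n hn => epoch_error_le h1 h2 (Finset.mem_range.1 hn)
    _ = K * A + B * ∑ n ∈ Finset.range K, ∑ j ∈ Finset.Ico (n - n % q) n, D j := by
        rw [Finset.sum_add_distrib, Finset.sum_const, Finset.card_range, nsmul_eq_mul,
          Finset.mul_sum]
    _ ≤ _ := by gcongr; exact sum_epoch_le hq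

lemma sum_decrease_le {a b : ℝ≥0∞} (h3 : ∀ n < K, a * D n + Φ (n + 1) ≤ Φ n + b * E n) :
    ∀ N ≤ K, a * ∑ n ∈ Finset.range N, D n + Φ N ≤ Φ 0 + b * ∑ n ∈ Finset.range N, E n := by
  intro N hN
  induction N with
  | zero => simp
  | succ N ih =>
    rw [Finset.sum_range_succ, Finset.sum_range_succ, mul_add, mul_add]
    calc _ = a * ∑ n ∈ Finset.range N, D n + (a * D N + Φ (N + 1)) := by ring
      _ ≤ a * ∑ n ∈ Finset.range N, D n + (Φ N + b * E N) := add_le_add le_rfl (h3 N hN)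
      _ = (a * ∑ n ∈ Finset.range N, D n + Φ N) + b * E N := by ring
      _ ≤ (Φ 0 + b * ∑ n ∈ Finset.range N, E n) + b * E N :=
          add_le_add (ih (by omega)) le_rfl
      _ = _ := by ring

/-- Finiteness is needed before terms can be subtracted. At each index, finite `Φ` and `E` force a
finite `D` because `a ≠ 0`, and this makes the next `Φ` and `E` finite. -/
lemma recursion_ne_top {A B a b : ℝ≥0∞} (hA : A ≠ ∞) (hB : B ≠ ∞) (ha : a ≠ 0) (hb : b ≠ ∞)
    (h0 : Φ 0 ≠ ∞) (h1 : ∀ n < K, n % q = 0 → E n ≤ A)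
    (h2 : ∀ n, n + 1 < K → (n + 1) % q ≠ 0 → E (n + 1) ≤ E n + B * D n)
    (h3 : ∀ n < K, a * D n + Φ (n + 1) ≤ Φ n + b * E n) {n : ℕ} (hn : n < K) :
    D n ≠ ∞ ∧ E n ≠ ∞ ∧ Φ (n + 1) ≠ ∞ := by
  have step : ∀ n < K, Φ n ≠ ∞ → E n ≠ ∞ → D n ≠ ∞ ∧ E n ≠ ∞ ∧ Φ (n + 1) ≠ ∞ := by
    intro n hn hΦ hE
    have hfin : a * D n + Φ (n + 1) ≠ ∞ :=
      ne_top_of_le_ne_top (ENNReal.add_ne_top.2 ⟨hΦ, ENNReal.mul_ne_top hb hE⟩) (h3 n hn)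
    obtain ⟨h4, h5⟩ := ENNReal.add_ne_top.1 hfin
    refine ⟨fun h => h4 ?_, hE, h5⟩
    rw [h, ENNReal.mul_top ha]
  induction n with
  | zero => exact step 0 hn h0 (ne_top_of_le_ne_top hA (h1 0 hn (Nat.zero_mod q)))
  | succ n ih =>
    obtain ⟨hD, hE, hΦ⟩ := ih (by omega)
    refine step _ hn hΦ ?_
    by_cases hmod : (n + 1) % q = 0
    · exact ne_top_of_le_ne_top hA (h1 _ hn hmod)
    · exact ne_top_of_le_ne_top (ENNReal.add_ne_top.2 ⟨hE, ENNReal.mul_ne_top hB hD⟩) (h2 n hn hmod)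

/-- Insert the bound on `∑E` into the telescoped descent: the term `b q B ∑D` moves to the left,
where the gap `a - b q B` stays positive. -/
lemma recursion_bound {A B a b φ : ℝ} (hq : 1 ≤ q) (hK : 1 ≤ K) (hA : 0 ≤ A) (hB : 0 ≤ B)
    (ha : 0 < a) (hb : 0 ≤ b) (hφ : 0 ≤ φ) (hgap : 0 < a - b * (q * B))
    (h0 : Φ 0 ≤ ENNReal.ofReal φ)
    (h1 : ∀ n < K, n % q = 0 → E n ≤ ENNReal.ofReal A)
    (h2 : ∀ n, n + 1 < K → (n + 1) % q ≠ 0 → E (n + 1) ≤ E n + ENNReal.ofReal B * D n)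
    (h3 : ∀ n < K, ENNReal.ofReal a * D n + Φ (n + 1) ≤ Φ n + ENNReal.ofReal b * E n) :
    ∑ n ∈ Finset.range K, D n ≤ ENNReal.ofReal (K * ((φ / K + b * A) / (a - b * (q * B)))) ∧
    ∑ n ∈ Finset.range K, E n ≤
      ENNReal.ofReal (K * (A + q * B * ((φ / K + b * A) / (a - b * (q * B))))) := by
  have hfin := fun n (hn : n < K) => recursion_ne_top ENNReal.ofReal_ne_top ENNReal.ofReal_ne_top
    (ENNReal.ofReal_pos.2 ha).ne' ENNReal.ofReal_ne_top
    (ne_top_of_le_ne_top ENNReal.ofReal_ne_top h0) h1 h2 h3 hn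
  have hDfin : ∑ n ∈ Finset.range K, D n ≠ ∞ :=
    ENNReal.sum_ne_top.2 fun n hn => (hfin n (Finset.mem_range.1 hn)).1
  have hEfin : ∑ n ∈ Finset.range K, E n ≠ ∞ :=
    ENNReal.sum_ne_top.2 fun n hn => (hfin n (Finset.mem_range.1 hn)).2.1
  have hsum := sum_error_le hq h1 h2
  have hdec := (le_self_add.trans (sum_decrease_le h3 K le_rfl)).trans (add_le_add_left h0 _)
  have hK0 : (0 : ℝ) < K := by exact_mod_cast hK
  obtain ⟨sd, hsd, hsd'⟩ : ∃ sd : ℝ, 0 ≤ sd ∧ ∑ n ∈ Finset.range K, D n = ENNReal.ofReal sd :=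
    ⟨_, ENNReal.toReal_nonneg, (ENNReal.ofReal_toReal hDfin).symm⟩
  obtain ⟨se, hse, hse'⟩ : ∃ se : ℝ, 0 ≤ se ∧ ∑ n ∈ Finset.range K, E n = ENNReal.ofReal se :=
    ⟨_, ENNReal.toReal_nonneg, (ENNReal.ofReal_toReal hEfin).symm⟩
  rw [hsd', hse'] at hsum hdec
  rw [← ENNReal.ofReal_natCast, ← ENNReal.ofReal_natCast, ← ENNReal.ofReal_mul hK0.le,
    ← ENNReal.ofReal_mul (by positivity), ← ENNReal.ofReal_mul hB,
    ← ENNReal.ofReal_add (by positivity) (by positivity),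
    ENNReal.ofReal_le_ofReal_iff (by positivity)] at hsum
  rw [← ENNReal.ofReal_mul ha.le, ← ENNReal.ofReal_mul hb,
    ← ENNReal.ofReal_add (by positivity) (by positivity),
    ENNReal.ofReal_le_ofReal_iff (by positivity)] at hdec
  have hsdQ : sd ≤ K * ((φ / K + b * A) / (a - b * (q * B))) := by
    rw [← mul_div_assoc, le_div_iff₀ hgap, mul_add, mul_div_cancel₀ _ hK0.ne']
    nlinarith [mul_le_mul_of_nonneg_left hsum hb]
  rw [hsd', hse']
  refine ⟨ENNReal.ofReal_le_ofReal hsdQ, ENNReal.ofReal_le_ofReal (hsum.trans ?_)⟩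
  have := mul_le_mul_of_nonneg_left hsdQ (show 0 ≤ B * q by positivity)
  linarith

end Recursion

/-! ### Averaging over the output index -/

section Average

variable {Ω : Type*} {mΩ : MeasurableSpace Ω} {μ : Measure Ω} [IsProbabilityMeasure μ] {K : ℕ}

/-- Cauchy–Schwarz in the form `u ≤ l/2 + u²/(2l)` with `l` near `√s`, which needs no measurability
of `u`. The `ε` keeps `l` positive when `s = 0`. -/
lemma average_lintegral_le_sqrt (hK : 1 ≤ K) {u : ℕ → Ω → ℝ} {s : ℝ} (hs : 0 ≤ s)
    (h : ∑ n ∈ Finset.range K, ∫⁻ ω, ENNReal.ofReal (u n ω ^ 2) ∂μ ≤ ENNReal.ofReal (K * s)) :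
    (K : ℝ≥0∞)⁻¹ * ∑ n ∈ Finset.range K, ∫⁻ ω, ENNReal.ofReal (u n ω) ∂μ
      ≤ ENNReal.ofReal (√s) := by
  have hK0 : (0 : ℝ) < K := by exact_mod_cast hK
  refine ENNReal.le_of_forall_pos_le_add fun ε hε _ => ?_
  set l := √s + ε
  have hl : 0 < l := by positivity
  have hpt : ∀ n, ∫⁻ ω, ENNReal.ofReal (u n ω) ∂μ ≤
      ENNReal.ofReal (l / 2) + ENNReal.ofReal (1 / (2 * l)) *
        ∫⁻ ω, ENNReal.ofReal (u n ω ^ 2) ∂μ := fun n => by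
    calc _ ≤ ∫⁻ ω, (ENNReal.ofReal (l / 2) + ENNReal.ofReal (1 / (2 * l)) *
          ENNReal.ofReal (u n ω ^ 2)) ∂μ := by
          refine lintegral_mono fun ω => ?_
          rw [← ENNReal.ofReal_mul (by positivity), ← ENNReal.ofReal_add (by positivity)
            (by positivity)]
          apply ENNReal.ofReal_le_ofReal
          have : l / 2 + 1 / (2 * l) * u n ω ^ 2 - u n ω = (2 * l)⁻¹ * (l - u n ω) ^ 2 := by
            field_simp; ring
          have : 0 ≤ (2 * l)⁻¹ * (l - u n ω) ^ 2 := by positivity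
          linarith
      _ = _ := by
          rw [lintegral_add_left measurable_const, lintegral_const, measure_univ, mul_one,
            lintegral_const_mul' _ _ ENNReal.ofReal_ne_top]
  have hsum : ∑ n ∈ Finset.range K, ∫⁻ ω, ENNReal.ofReal (u n ω) ∂μ ≤
      ENNReal.ofReal (K * (√s + ε)) := by
    calc _ ≤ ∑ n ∈ Finset.range K, (ENNReal.ofReal (l / 2) + ENNReal.ofReal (1 / (2 * l)) *
          ∫⁻ ω, ENNReal.ofReal (u n ω ^ 2) ∂μ) := Finset.sum_le_sum fun n _ => hpt n
      _ = K * ENNReal.ofReal (l / 2) + ENNReal.ofReal (1 / (2 * l)) *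
          ∑ n ∈ Finset.range K, ∫⁻ ω, ENNReal.ofReal (u n ω ^ 2) ∂μ := by
          rw [Finset.sum_add_distrib, Finset.sum_const, Finset.card_range, nsmul_eq_mul,
            Finset.mul_sum]
      _ ≤ K * ENNReal.ofReal (l / 2) + ENNReal.ofReal (1 / (2 * l)) * ENNReal.ofReal (K * s) := by
          gcongr
      _ = ENNReal.ofReal (K * (l / 2 + s / (2 * l))) := by
          rw [← ENNReal.ofReal_natCast, ← ENNReal.ofReal_mul hK0.le,
            ← ENNReal.ofReal_mul (by positivity),
            ← ENNReal.ofReal_add (by positivity) (by positivity)]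
          congr 1; field_simp
      _ ≤ _ := by
          refine ENNReal.ofReal_le_ofReal (mul_le_mul_of_nonneg_left ?_ hK0.le)
          have h1 : s / (2 * l) ≤ √s / 2 := by
            rw [div_le_div_iff₀ (by positivity) (by norm_num)]
            have h2 : √s * √s = s := Real.mul_self_sqrt hs
            have h3 : 0 ≤ √s * ε := by positivity
            simp only [l]
            nlinarith
          have : (0 : ℝ) < ε := hε
          simp only [l] at h1 ⊢
          linarith
  calc _ ≤ (K : ℝ≥0∞)⁻¹ * ENNReal.ofReal (K * (√s + ε)) := by gcongr
    _ = ENNReal.ofReal (√s + ε) := by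
        rw [ENNReal.ofReal_mul hK0.le, ENNReal.ofReal_natCast, ← mul_assoc,
          ENNReal.inv_mul_cancel (by exact_mod_cast (by omega : K ≠ 0)) (ENNReal.natCast_ne_top K),
          one_mul]
    _ = _ := by rw [ENNReal.ofReal_add (Real.sqrt_nonneg s) ε.coe_nonneg, ENNReal.ofReal_coe_nnreal]

/-- Expectation of a process evaluated at an independent uniform index. -/
lemma lintegral_uniform_index (hK : 1 ≤ K) {Y : Ω → ℕ} (hY : Measurable Y)
    (hlaw : ∀ k ∈ Finset.Icc 1 K, μ {ω | Y ω = k} = (K : ℝ≥0∞)⁻¹) {β : Type*}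
    [mβ : MeasurableSpace β] {Z : Ω → β} (hZ : Measurable Z) (hind : IndepFun Y Z μ)
    {R : ℕ → Ω → ℝ≥0∞} (hR : ∀ k ∈ Finset.Icc 1 K, Measurable[mβ.comap Z] (R k)) :
    AEMeasurable (fun ω => R (Y ω) ω) μ ∧
      ∫⁻ ω, R (Y ω) ω ∂μ = (K : ℝ≥0∞)⁻¹ * ∑ k ∈ Finset.Icc 1 K, ∫⁻ ω, R k ω ∂μ := by
  have hK0 : (K : ℝ≥0∞) ≠ 0 := by exact_mod_cast (by omega : K ≠ 0)
  have hset : ∀ k, MeasurableSet {ω | Y ω = k} := fun k => hY (measurableSet_singleton k)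
  have hmem : ∀ᵐ ω ∂μ, Y ω ∈ Finset.Icc 1 K := by
    have hone : μ {ω | Y ω ∈ Finset.Icc 1 K} = 1 := by
      have e : {ω | Y ω ∈ Finset.Icc 1 K} = ⋃ k ∈ Finset.Icc 1 K, {ω | Y ω = k} := by
        ext ω; simp
      rw [e, measure_biUnion_finset ?_ fun k _ => hset k, Finset.sum_congr rfl hlaw,
        Finset.sum_const, Nat.card_Icc, Nat.add_sub_cancel, nsmul_eq_mul,
        ENNReal.mul_inv_cancel hK0 (ENNReal.natCast_ne_top K)]
      intro i _ j _ hij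
      exact Set.disjoint_left.2 fun ω hi hj => hij (hi.symm.trans hj)
    exact (prob_compl_eq_zero_iff (hY (Finset.Icc 1 K).measurableSet)).2 hone
  set ind : ℕ → Ω → ℝ≥0∞ := fun k => {ω | Y ω = k}.indicator 1
  -- `R k` is controlled only for `1 ≤ k ≤ K`, and `Y` takes other values only on a null set; hence
  -- the process at `Y` is merely a.e. measurable. Independence then factors each term of the finite
  -- sum.
  have hae : (fun ω => R (Y ω) ω) =ᵐ[μ] fun ω => ∑ k ∈ Finset.Icc 1 K, ind k ω * R k ω := by
    filter_upwards [hmem] with ω hω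
    rw [Finset.sum_eq_single_of_mem (Y ω) hω]
    · simp [ind]
    · intro k _ hk
      simp [ind, hk.symm]
  have hindY : ∀ k, Measurable[MeasurableSpace.comap Y inferInstance] (ind k) := fun k => by
    have e : ind k = (({k} : Set ℕ).indicator 1 : ℕ → ℝ≥0∞) ∘ Y := by
      funext ω; simp [ind, Set.indicator_apply, Pi.single_apply]
    rw [e]
    exact Measurable.of_discrete.comp (comap_measurable Y)
  have hterm : ∀ k ∈ Finset.Icc 1 K, Measurable fun ω => ind k ω * R k ω := fun k hk =>
    ((hindY k).mono hY.comap_le le_rfl).mul ((hR k hk).mono hZ.comap_le le_rfl)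
  refine ⟨⟨_, Finset.measurable_sum _ hterm, hae⟩, ?_⟩
  rw [lintegral_congr_ae hae, lintegral_finsetSum _ hterm, Finset.mul_sum]
  refine Finset.sum_congr rfl fun k hk => ?_
  rw [lintegral_mul_eq_lintegral_mul_lintegral_of_independent_measurableSpace hY.comap_le
    hZ.comap_le hind (hindY k) (hR k hk), lintegral_indicator_one (hset k), hlaw k hk]

end Average

end Spider


/-! ### Assembly of the final bound -/

theorem theorem2 {d : ℕ} (hd : 2 ≤ d)
    {Ξ : Type*} [MeasurableSpace Ξ] (P : Measure Ξ) [IsProbabilityMeasure P]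
    (X : Set (Spider.Vec d)) (F : Spider.Vec d → Ξ → ℝ)
    (hprog : Spider.IsStochasticProgram X F P)
    (σ : ℝ) (hσ : Spider.BoundedVariance X F P σ)
    (L : ℝ) (hL : 0 ≤ L) (hsmooth : Spider.MeanSquaredSmooth X F P L)
    (fLow : ℝ) (hfLow : ∀ x ∈ X, fLow ≤ Spider.objective F P x)
    (η ρ : ℝ) (hη : 0 < η) (hρ : 0 < ρ)
    (K q m m₁ : ℕ) (hK : 1 ≤ K) (hq : 1 ≤ q) (hm : 1 ≤ m) (hm₁ : 1 ≤ m₁)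
    {Ω : Type*} [MeasurableSpace Ω] (μ : Measure Ω) [IsProbabilityMeasure μ]
    (ζ : ℕ → ℕ → Ω → Ξ) (x G : ℕ → Ω → Spider.Vec d) (Y : Ω → ℕ)
    (hrun : Spider.IsRun X F P (Spider.proxTerm ρ) η K q m m₁ μ ζ x G Y)
    (hinit : Integrable (fun ω => Spider.objective F P (x 1 ω)) μ)
    (Δf t W c : ℝ)
    (hΔf : Δf = (∫ ω, Spider.objective F P (x 1 ω) ∂μ) - fLow)
    (ht : t = 2 * η / ρ) (hW : W = Spider.dimFactor d) (hc : c = Real.exp 2)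
    (hpos : 0 < ρ / (4 * η) - L / 2 - 2 * t * W ^ 2 * L ^ 2 * q / m) :
    AEMeasurable (fun ω => Spider.residual (Spider.objective F P) X (x (Y ω + 1) ω)) μ ∧
    ∫⁻ ω, Spider.residual (Spider.objective F P) X (x (Y ω + 1) ω) ∂μ ≤
      ENNReal.ofReal
        ((L + (ρ + 1) / η + √(4 * W ^ 2 * L ^ 2 * q / m)) *
            √((Δf / K + t * W * (c * Real.log d * σ ^ 2) / (2 * m₁)) /
              (ρ / (4 * η) - L / 2 - 2 * t * W ^ 2 * L ^ 2 * q / m))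
          + √(W * (c * Real.log d * σ ^ 2) / m₁)) := by
  obtain ⟨ω₀⟩ : Nonempty Ω := nonempty_of_isProbabilityMeasure μ
  have hne : X.Nonempty := ⟨_, hrun.init_mem ω₀⟩
  have hle := fun S => Spider.history_le hrun.init_measurable hrun.sample_measurable S
  have hr : (1 : ℝ) ≤ Spider.logExponent d := by exact_mod_cast Spider.one_le_logExponent hd
  have hm0 : (0 : ℝ) < m := by exact_mod_cast hm
  have hm₁0 : (0 : ℝ) < m₁ := by exact_mod_cast hm₁
  have hK0 : (0 : ℝ) < K := by exact_mod_cast hK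
  -- Hence `Ω c log d` in the statement equals `W²`, the factor produced by the averaging bound.
  have hWc : c * Real.log d = W := by rw [hc, hW, Spider.dimFactor]
  -- the residual at the random index
  have hindex := Spider.lintegral_uniform_index hK hrun.index_measurable hrun.index_law
    (hrun.init_measurable.prodMk (measurable_pi_lambda _ fun p => hrun.sample_measurable _ _))
    hrun.index_indep
    (R := fun k ω => Spider.residual (Spider.objective F P) X (x (k + 1) ω))
    (fun k hk => by
      have hk' := Finset.mem_Icc.1 hk
      exact (hrun.measurable_residual hprog hne hρ.le hL hsmooth (by omega) (by omega)).mono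
        (Spider.history_le_comap _) le_rfl)
  refine ⟨hindex.1, hindex.2.le.trans ?_⟩
  -- the recursion
  set A : ℝ := W ^ 2 * σ ^ 2 / m₁
  set B : ℝ := 4 * W ^ 2 * L ^ 2 / m
  have hA : 0 ≤ A := by positivity
  have hB : 0 ≤ B := by positivity
  -- With `t = 2η/ρ` and the 4 in `B`, the correction is `b q B` for `b = η/ρ`, which is the gap
  -- required by the recursion.
  have hgap : ρ / (4 * η) - L / 2 - 2 * t * W ^ 2 * L ^ 2 * q / m
      = (ρ / (4 * η) - L / 2) - η / ρ * (q * B) := by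
    simp only [B]; rw [ht]; field_simp; ring
  rw [hgap] at hpos ⊢
  have ha : 0 < ρ / (4 * η) - L / 2 := by
    have : 0 ≤ η / ρ * (q * B) := by positivity
    linarith
  have hΔint : Integrable (fun ω => Spider.objective F P (x 1 ω) - fLow) μ :=
    hinit.sub (integrable_const _)
  have hΔeq : ∫ ω, (Spider.objective F P (x 1 ω) - fLow) ∂μ = Δf := by
    rw [integral_sub hinit (integrable_const _), integral_const, probReal_univ, one_smul, hΔf]
  have hΔnn : ∀ ω, 0 ≤ Spider.objective F P (x 1 ω) - fLow := fun ω =>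
    sub_nonneg.2 (hfLow _ (hrun.init_mem ω))
  have hΔ : 0 ≤ Δf := hΔeq ▸ integral_nonneg hΔnn
  -- Index `n` of the recursion stands for iteration `n + 1`.
  have hmod : ∀ n, n + 1 ≡ 1 [MOD q] ↔ n % q = 0 := fun n => by
    have h : n ≡ 0 [MOD q] ↔ n % q = 0 := by rw [Nat.ModEq, Nat.zero_mod]
    rw [← h]
    exact ⟨fun h => Nat.ModEq.add_right_cancel' 1 h, fun h => Nat.ModEq.add_right 1 h⟩
  obtain ⟨hD, hE⟩ := Spider.recursion_bound (K := K) (q := q) (A := A) (B := B)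
    (a := ρ / (4 * η) - L / 2) (b := η / ρ) (φ := Δf)
    (D := fun n => ∫⁻ ω, ENNReal.ofReal (Spider.l1Norm (x (n + 2) ω - x (n + 1) ω) ^ 2) ∂μ)
    (E := fun n => ∫⁻ ω, ENNReal.ofReal (Spider.lpSq (Spider.logExponent d)
      (Spider.gradError F P x G (n + 1) ω)) ∂μ)
    (Φ := fun n => ∫⁻ ω, ENNReal.ofReal (Spider.objective F P (x (n + 1) ω) - fLow) ∂μ)
    hq hK hA hB ha (by positivity) hΔ hpos
    (by
      rw [← hΔeq, ofReal_integral_eq_lintegral_ofReal hΔint (Filter.Eventually.of_forall hΔnn)])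
    (fun n hn hnq => by
      simp only [A]; rw [hW]
      exact hrun.lintegral_gradError_restart hd hprog hne hρ.le hσ hm₁ (by omega) hn
        ((hmod n).2 hnq))
    (fun n hn hnq => by
      simp only [B]; rw [hW]
      exact hrun.lintegral_gradError_update hd hprog hne hρ.le hsmooth hm (by omega) hn
        (fun h => hnq ((hmod (n + 1)).1 h)))
    (fun n hn => hrun.lintegral_descent hd hprog hne hρ hη hL hsmooth ha.le hfLow (by omega) hn)
  set Q : ℝ := (Δf / K + η / ρ * A) / (ρ / (4 * η) - L / 2 - η / ρ * (q * B))
  have hQ : 0 ≤ Q := by positivity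
  have hE' : ∑ n ∈ Finset.range K, ∫⁻ ω, ENNReal.ofReal (Spider.linfNorm
      (Spider.gradError F P x G (n + 1) ω) ^ 2) ∂μ ≤ ENNReal.ofReal (K * (A + q * B * Q)) :=
    le_trans (Finset.sum_le_sum fun n _ => lintegral_mono fun ω =>
      ENNReal.ofReal_le_ofReal (Spider.sq_linfNorm_le_lpSq hr _)) hE
  have hN := Spider.average_lintegral_le_sqrt hK hQ hD
  have he := Spider.average_lintegral_le_sqrt hK (by positivity) hE'
  have hNm : ∀ n < K, Measurable fun ω =>
      ENNReal.ofReal (Spider.l1Norm (x (n + 2) ω - x (n + 1) ω)) := fun n hn => by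
    have h1 := ((hrun.measurable_iterate_estimate hprog hne hρ.le (by omega : 1 ≤ n + 1)).1
      (by omega)).mono (hle _) le_rfl
    have h2 := ((hrun.measurable_iterate_estimate hprog hne hρ.le (by omega : 1 ≤ n + 2)).1
      (by omega)).mono (hle _) le_rfl
    exact (Spider.continuous_l1Norm.measurable.comp (h2.sub h1)).ennreal_ofReal
  have hc1 : 0 ≤ L + (ρ + 1) / η := by positivity
  calc (K : ℝ≥0∞)⁻¹ * ∑ k ∈ Finset.Icc 1 K,
        ∫⁻ ω, Spider.residual (Spider.objective F P) X (x (k + 1) ω) ∂μ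
      = (K : ℝ≥0∞)⁻¹ * ∑ n ∈ Finset.range K,
        ∫⁻ ω, Spider.residual (Spider.objective F P) X (x (n + 1 + 1) ω) ∂μ := by
        rw [Finset.range_eq_Ico, Finset.sum_Ico_add' (fun k => ∫⁻ ω,
          Spider.residual (Spider.objective F P) X (x (k + 1) ω) ∂μ) 0 K 1]
        rfl
    _ ≤ (K : ℝ≥0∞)⁻¹ * ∑ n ∈ Finset.range K, (ENNReal.ofReal (L + (ρ + 1) / η) *
          ∫⁻ ω, ENNReal.ofReal (Spider.l1Norm (x (n + 2) ω - x (n + 1) ω)) ∂μ +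
        ∫⁻ ω, ENNReal.ofReal (Spider.linfNorm (Spider.gradError F P x G (n + 1) ω)) ∂μ) := by
        gcongr with n hn
        have hn' := Finset.mem_range.1 hn
        rw [← lintegral_const_mul' _ _ ENNReal.ofReal_ne_top,
          ← lintegral_add_left ((hNm n hn').const_mul _)]
        exact lintegral_mono fun ω =>
          hrun.residual_le hprog hρ.le hη hL hsmooth (by omega) hn' ω
    _ = ENNReal.ofReal (L + (ρ + 1) / η) * ((K : ℝ≥0∞)⁻¹ * ∑ n ∈ Finset.range K,
          ∫⁻ ω, ENNReal.ofReal (Spider.l1Norm (x (n + 2) ω - x (n + 1) ω)) ∂μ) +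
        (K : ℝ≥0∞)⁻¹ * ∑ n ∈ Finset.range K,
          ∫⁻ ω, ENNReal.ofReal (Spider.linfNorm (Spider.gradError F P x G (n + 1) ω)) ∂μ := by
        rw [Finset.sum_add_distrib, ← Finset.mul_sum, mul_add, mul_left_comm]
    _ ≤ ENNReal.ofReal (L + (ρ + 1) / η) * ENNReal.ofReal (√Q)
        + ENNReal.ofReal (√(A + q * B * Q)) := by gcongr
    _ = ENNReal.ofReal ((L + (ρ + 1) / η) * √Q + √(A + q * B * Q)) := by
        rw [← ENNReal.ofReal_mul hc1, ← ENNReal.ofReal_add (by positivity) (by positivity)]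
    _ ≤ _ := by
        apply ENNReal.ofReal_le_ofReal
        have e1 : t * W * (c * Real.log d * σ ^ 2) / (2 * m₁) = η / ρ * A := by
          rw [hWc, ht]; simp only [A]; field_simp
        have e2 : W * (c * Real.log d * σ ^ 2) / m₁ = A := by
          rw [hWc]; simp only [A]; ring
        have e3 : 4 * W ^ 2 * L ^ 2 * q / m = q * B := by simp only [B]; ring
        rw [e1, e2, e3]
        -- Subadditivity of the root splits the error: the `√Q` part joins the step-length
        -- coefficient, and `√A` is the separate noise term.
        have h1 : √(A + q * B * Q) ≤ √A + √(q * B) * √Q := by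
          rw [← Real.sqrt_mul (by positivity)]
          have hB' : 0 ≤ q * B * Q := by positivity
          refine Real.sqrt_le_iff.2 ⟨by positivity, ?_⟩
          nlinarith [Real.sq_sqrt hA, Real.sq_sqrt hB', Real.sqrt_nonneg A,
            mul_nonneg (Real.sqrt_nonneg A) (Real.sqrt_nonneg (q * B * Q))]
        calc _ ≤ (L + (ρ + 1) / η) * √Q + (√A + √(q * B) * √Q) := by gcongr
          _ = _ := by ring
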